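/- **Setting.** An abduction instance $A=(B,O,S)$ consists of a finite list $B$ of function-free Horn axioms $q(\vec Y)\Leftarrow p_1(\vec X^1)\wedge\dots\wedge p_r(\vec X^r)$ with $r\ge 1$ (each with a unique identifier), a goal $O$, which is an existentially quantified conjunction of atoms whose variables are replaced by their own constants that are not sort names, and a finite set $S$ of constants, the sort names. Arguments of atoms are variables or constants; arities are arbitrary. $B$ is acyclic: the graph on axioms with an edge from $a$ to $a'$ whenever a body atom of $a$ unifies (variables renamed apart) with the head of $a'$ has no cycle. Fix a strict total order $<$ on ground terms that extends the order of the integers. **Proof graphs.** A hypothesis is obtained from $O$ by finitely many operations: *back-chaining* an atom $P=\theta(q(\vec Y))$ over an axiom $a$ adds the atoms $P_i'=\theta(p_i(\vec X^i))$, where each variable $z$ that occurs only in the body is mapped to the Skolem term $s(a,z,\theta(\vec Y))$; *unification* of two distinct atoms with the same predicate and arity adds the equations between their differing arguments, none of which may be a sort name. Each atom is justified by at most one back-chaining or one factoring, or not at all. The proof graph $G$ has the atoms of the hypothesis as nodes; it has an edge from each $P_i'$ to $P$ for a back-chaining of $P$, and, for a unification of $P$ with $Q$ in which $P$ is factored with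 $Q$, an edge from $Q$ to $P$; and it is acyclic. Let $A(G)$ be the set of nodes without incoming edge. Define * $card(G)=|A(G)|$; * $coh(G)=|\{(a,b): a,b\in O,\ a<b,$ no node of $G$ reaches both $a$ and $b\}|$ (a node reaches itself); * $wa(G)=\sum_{a\in A(G)}\min cost(a)$, where $cost(Q)$ is the set that consists of $100$ if $Q\in O$; of $\max\{1,\lfloor \frac{1.2}{r}\min cost(P)\rfloor\}$ for each atom $P$ back-chained over an axiom with $r$ body atoms such that $Q$ is one of the body atoms added; and of $\min cost(P)$ for each $P$ factored with $Q$. (This is weighted abduction with initial costs $100$ and weights $1.2/r$, where each cost obtained by back-chaining is rounded down to an integer and is at least $1$.) **Encoding.** $P_{\mathrm{BWD\text{-}A}}(A)$ consists of the facts $goal(c(o,\vec v))$ for each goal atom $o(\vec v)$ and $sortname(s)$ for $s\in S$; for each axiom $a$, with $Z_1,\dots,Z_v$ the variables only in its body, the rules $mayinfervia(a,c(q,\vec Y),l(Z_1,\dots,Z_v))\leftarrow pot(c(q,\vec Y)),\,Z_1=s(a,1,\vec Y),\dots,Z_v=s(a,v,\vec Y)$ and $inferenceneeds(c(q,\vec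 Y),a,c(p_i,\vec X^i))\leftarrow mayinfervia(a,c(q,\vec Y),l(Z_1,\dots,Z_v))$ for $1\le i\le r$; and the rules $$\begin{aligned} &pot(X)\leftarrow goal(X).\qquad pot(P)\leftarrow inferenceneeds(\_,\_,P).\qquad true(P)\leftarrow goal(P).\\ &1\le\{infer(P);fai(P)\}\le1\leftarrow true(P).\\ &1\le\{infervia(R,P):mayinfervia(R,P,\_)\}\le1\leftarrow infer(P).\\ &true(Q)\leftarrow infervia(R,P),inferenceneeds(P,R,Q).\\ &hu(X)\leftarrow pot(c(p,\vec X))\ \ (X\text{ in }\vec X).\qquad uhu(X)\leftarrow hu(X),not\ sortname(X).\\ &\{eq(A,B):uhu(A),uhu(B),A\ne B\}\leftarrow.\qquad eq(A,A)\leftarrow hu(A).\\ &\leftarrow eq(A,B),not\ eq(B,A).\qquad \leftarrow eq(A,B),eq(B,C),A\ne B,B\ne C,A\ne C,not\ eq(A,C).\\ &fa(P)\leftarrow fai(P).\\ &factorcluster(c(p,\vec T),c(p,\vec S))\leftarrow fa(c(p,\vec S)),fa(c(p,\vec T)),eq(S_1,T_1),\dots,eq(S_k,T_k),c(p,\vec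 S)<c(p,\vec T).\\ &factorclusterabove(A)\leftarrow factorcluster(A,\_).\\ &factorvia(A,B)\leftarrow factorcluster(A,B),not\ factorclusterabove(B).\\ &factor(P)\leftarrow factorvia(P,\_).\qquad abduce(P)\leftarrow fa(P),not\ factor(P). \end{aligned}$$ The modules are $$\begin{aligned} P_{card}:\ &{:}\sim abduce(P).\,[1@1,P]\\ P_{coh}:\ &reach(P,P)\leftarrow goal(P).\\ &reach(Q,F)\leftarrow reach(P,F),infervia(R,P),inferenceneeds(P,R,Q).\\ &reach(Q,F)\leftarrow reach(P,F),factorvia(P,Q).\\ &reachfromboth(P,Q)\leftarrow goal(P),goal(Q),P<Q,reach(N,P),reach(N,Q).\\ &{:}\sim goal(P),goal(Q),P<Q,not\ reachfromboth(P,Q).\,[1@1,P,Q]\\ P_{wa}:\ &numberofbodies(a,r).\ \text{ (for each axiom } a \text{ with } r \text{ body atoms)}\qquad pcost(P,100)\leftarrow goal(P).\\ &pcost(Q,M)\leftarrow infervia(R,P),inferenceneeds(P,R,Q),M=\#max\{(C\cdot6/5)/N;1\},pcost(P,C),numberofbodies(R,N).\\ &pcost(Q,C)\leftarrow factorvia(P,Q),pcost(P,C).\\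 &cost(P,C)\leftarrow abduce(P),C=\#min\{I:pcost(P,I)\}.\\ &{:}\sim cost(P,C).\,[C@1,P] \end{aligned}$$ with integer division. Answer sets are minimal models of the FLP-reduct (with the usual meaning of choice rules); the cost of an answer set is the sum of the weights over the distinct weight–tuple pairs of weak constraints whose body it satisfies. **Proposition.** For each module $M\in\{P_{card},P_{coh},P_{wa}\}$, each answer set $I$ of $P_{\mathrm{BWD\text{-}A}}(A)\cup M$ represents a proof graph $G$ of a hypothesis of $A$: its nodes are represented by $true$, its back-chained atoms with the axiom used by $infervia$, its factored atoms by $factorvia$, and its edges by $infervia$ with $inferenceneeds$ and by $factorvia$. The cost of $I$ is a finite sum and is equal to $card(G)$ if $M=P_{card}$, to $coh(G)$ if $M=P_{coh}$, and to $wa(G)$ if $M=P_{wa}$. In the last case the cost labelling of $G$ determines a unique value $wa(G)$, and the cost of each abduced atom in $I$ is an integer $\ge1$. -/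

import Mathlib

namespace AbdASP

universe u

/-! ## Ground terms and ground first-order atoms -/

/-- Ground terms over a set `C` of constant and predicate names. -/
inductive Term (C : Type u) : Type u
  /-- an integer -/
  | int (n : ℤ)
  /-- a constant of the knowledge base or of the goal (possibly a sort name) -/
  | const (c : C)
  /-- the constant (never a sort name) standing for the `v`-th existential variable of the goal -/
  | gvar (v : ℕ)
  /-- the unique identifier of the `a`-th axiom -/
  | rid (a : ℕ)
  /-- the Skolem term `s(a, z, t₁, …, tₘ)` for the variable `z` of the `a`-th axiom -/
  | sk (a z : ℕ) (args : List (Term C))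
  /-- the term `c(p, t₁, …, tₘ)`, which represents the atom `p(t₁, …, tₘ)` -/
  | c (p : C) (args : List (Term C))
  /-- the term `l(t₁, …, tₘ)` that collects Skolem terms -/
  | l (args : List (Term C))

/-- A ground first-order atom `p(t₁, …, tₘ)`. -/
structure GAtom (C : Type u) : Type u where
  pred : C
  args : List (Term C)

/-- The term `c(p, t₁, …, tₘ)` that represents the atom `p(t₁, …, tₘ)`. -/
def GAtom.enc {C : Type u} (P : GAtom C) : Term C := Term.c P.pred P.args

/-! ## Abduction instances -/

/-- An argument of an atom in an axiom or in the goal: a variable or a constant. -/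
inductive Arg (C : Type u) : Type u
  | var (v : ℕ)
  | const (c : C)

/-- A function-free first-order atom, possibly with variables. -/
structure FAtom (C : Type u) : Type u where
  pred : C
  args : List (Arg C)

/-- Application of a ground substitution to an argument. -/
def Arg.inst {C : Type u} (σ : ℕ → Term C) : Arg C → Term C
  | .var v => σ v
  | .const c => Term.const c

/-- Application of a ground substitution to an atom. -/
def FAtom.inst {C : Type u} (σ : ℕ → Term C) (p : FAtom C) : GAtom C :=
  ⟨p.pred, p.args.map (Arg.inst σ)⟩

/-- The variables of an atom. -/
def FAtom.vars {C : Type u} (p : FAtom C) : List ℕ :=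
  p.args.filterMap fun a => match a with
    | .var v => some v
    | .const _ => none

/-- A Horn clause `head ⇐ p₁ ∧ … ∧ pᵣ`. -/
structure HornAxiom (C : Type u) : Type u where
  head : FAtom C
  body : List (FAtom C)

/-- The variables `Z₁, …, Zᵥ` that occur in the body but not in the head. -/
def HornAxiom.bodyOnlyVars {C : Type u} (ax : HornAxiom C) : List ℕ :=
  ((ax.body.flatMap FAtom.vars).filter fun v => decide (v ∉ ax.head.vars)).dedup

/-- An abduction instance `(B, O, S)`: a finite list of axioms (an axiom is identified by its
position), an existentially quantified conjunction of atoms, and a finite set of sort names. -/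
structure Instance (C : Type u) : Type u where
  axioms : List (HornAxiom C)
  goal : List (FAtom C)
  sorts : Finset C

variable {C : Type u}

/-- The goal atoms `O`, where each existential variable is replaced by its own constant. -/
def Instance.goalAtoms (A : Instance C) : Set (GAtom C) :=
  {P | ∃ o ∈ A.goal, P = o.inst Term.gvar}

/-- `A.Feeds i j`: some body atom of the `i`-th axiom unifies with the head of the `j`-th axiom
(with variables renamed apart), i.e. these two function-free atoms have a common instance. -/
def Instance.Feeds (A : Instance C) (i j : ℕ) : Prop :=
  ∃ ax bx, A.axioms[i]? = some ax ∧ A.axioms[j]? = some bx ∧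
    ∃ p ∈ ax.body, ∃ σ τ : ℕ → Term C, p.inst σ = bx.head.inst τ

/-- The knowledge base is acyclic: no circular inference over its axioms is possible. -/
def Instance.Acyclic (A : Instance C) : Prop :=
  ∀ i, ¬ Relation.TransGen A.Feeds i i

/-- `A.Backchains i ax σ P`: the ground atom `P` is an instance of the head of the `i`-th axiom `ax`
under `σ`, and `σ` maps the variables that occur only in the body to their Skolem terms. The atoms
`p.inst σ` for `p ∈ ax.body` are the atoms that back-chaining from `P` over `ax` adds. -/
def Instance.Backchains (A : Instance C) (i : ℕ) (ax : HornAxiom C) (σ : ℕ → Term C)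
    (P : GAtom C) : Prop :=
  A.axioms[i]? = some ax ∧ ax.head.inst σ = P ∧
    ∀ z ∈ ax.bodyOnlyVars, σ z = Term.sk i z P.args

/-! ## Hypotheses and proof graphs -/

/-- A conjunction of ground atoms and of equalities between ground terms. -/
structure Hyp (C : Type u) : Type u where
  atoms : Set (GAtom C)
  eqs : Set (Term C × Term C)

/-- `t` is not a sort name of `A`. -/
def Instance.NotSort (A : Instance C) (t : Term C) : Prop :=
  ∀ s ∈ A.sorts, t ≠ Term.const s

/-- The equations `X = Y` for the pairs of distinct corresponding arguments of two atoms. -/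
def unifEqs (P Q : GAtom C) : Set (Term C × Term C) :=
  {e | e ∈ P.args.zip Q.args ∧ e.1 ≠ e.2}

/-- `P` and `Q` unify without identifying a sort name with another term. -/
def Instance.Unifiable (A : Instance C) (P Q : GAtom C) : Prop :=
  P.pred = Q.pred ∧ P.args.length = Q.args.length ∧
    ∀ e ∈ unifEqs P Q, A.NotSort e.1 ∧ A.NotSort e.2

/-- `P` has been neither back-chained (`bc`) nor factored (`fc`). -/
def Unjustified (bc : Set (GAtom C × ℕ)) (fc : Set (GAtom C × GAtom C)) (P : GAtom C) : Prop :=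
  (∀ i, (P, i) ∉ bc) ∧ ∀ Q, (P, Q) ∉ fc

/-- `Derives A H bc fc`: the hypothesis `H` is generated from the goal by a finite sequence of
back-chaining and unification operations, where `bc` consists of the pairs `(P, i)` such that `P` was
back-chained over the `i`-th axiom, and `fc` of the pairs `(P, Q)` such that `P` was factored with
`Q` (i.e. unified with `Q`, with the edge directed from `Q` to `P`). Each atom is justified by at
most one operation. -/
inductive Derives (A : Instance C) :
    Hyp C → Set (GAtom C × ℕ) → Set (GAtom C × GAtom C) → Prop
  | goal : Derives A ⟨A.goalAtoms, ∅⟩ ∅ ∅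
  | backchain {H : Hyp C} {bc : Set (GAtom C × ℕ)} {fc : Set (GAtom C × GAtom C)}
      {P : GAtom C} {i : ℕ} {ax : HornAxiom C} {σ : ℕ → Term C} :
      Derives A H bc fc → P ∈ H.atoms → Unjustified bc fc P → A.Backchains i ax σ P →
      Derives A ⟨H.atoms ∪ {Q | ∃ p ∈ ax.body, Q = p.inst σ}, H.eqs⟩ (insert (P, i) bc) fc
  | unify {H : Hyp C} {bc : Set (GAtom C × ℕ)} {fc : Set (GAtom C × GAtom C)}
      {P Q : GAtom C} :
      Derives A H bc fc → P ∈ H.atoms → Q ∈ H.atoms → P ≠ Q → Unjustified bc fc P →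
      A.Unifiable P Q →
      Derives A ⟨H.atoms, H.eqs ∪ unifEqs P Q⟩ bc (insert (P, Q) fc)

/-- The data of a proof graph: its nodes, the back-chained atoms with the axiom used, and the
pairs `(P, Q)` such that `P` is factored with `Q`. -/
structure Graph (C : Type u) : Type u where
  nodes : Set (GAtom C)
  chained : Set (GAtom C × ℕ)
  factored : Set (GAtom C × GAtom C)

/-- `G.Edge A Q P`: there is an edge from `Q` to `P`, i.e. `Q` is one of the body atoms of the
back-chaining of `P`, or `P` is factored with `Q`. -/
def Graph.Edge (A : Instance C) (G : Graph C) (Q P : GAtom C) : Prop :=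
  (∃ i ax σ, (P, i) ∈ G.chained ∧ A.Backchains i ax σ P ∧ ∃ p ∈ ax.body, Q = p.inst σ) ∨
    (P, Q) ∈ G.factored

/-- `G` is a proof graph with respect to the hypothesis `H` of `A`. -/
def IsProofGraph (A : Instance C) (H : Hyp C) (G : Graph C) : Prop :=
  Derives A H G.chained G.factored ∧ G.nodes = H.atoms ∧
    ∀ P, ¬ Relation.TransGen (G.Edge A) P P

/-- `A(G)`: the nodes without an incoming edge. -/
def Graph.abducedNodes (A : Instance C) (G : Graph C) : Set (GAtom C) :=
  {P | P ∈ G.nodes ∧ ∀ Q, ¬ G.Edge A Q P}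

/-! ## Objective functions of proof graphs -/

/-- Cardinality: the number of abduced nodes. -/
noncomputable def cardObj (A : Instance C) (G : Graph C) : ℕ :=
  (G.abducedNodes A).ncard

/-- The pairs of goal atoms `a < b` such that no node reaches both of them. -/
def unconnectedPairs (A : Instance C) (lt : Term C → Term C → Prop) (G : Graph C) :
    Set (GAtom C × GAtom C) :=
  {e | e.1 ∈ A.goalAtoms ∧ e.2 ∈ A.goalAtoms ∧ lt e.1.enc e.2.enc ∧
    ¬ ∃ n ∈ G.nodes, Relation.ReflTransGen (G.Edge A) n e.1 ∧
      Relation.ReflTransGen (G.Edge A) n e.2}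

/-- Coherence: the number of unconnected pairs. -/
noncomputable def cohObj (A : Instance C) (lt : Term C → Term C → Prop) (G : Graph C) : ℕ :=
  (unconnectedPairs A lt G).ncard

/-- `κ` labels each atom with its set of costs, for initial costs `ic`, the weight `w i k` of the
`k`-th body atom of the `i`-th axiom, and a function `ρ` applied to each cost obtained by
back-chaining (`ρ = id` means that there is no rounding). -/
def IsCostLabelling (A : Instance C) (ic : GAtom C → ℝ) (w : ℕ → ℕ → ℝ) (ρ : ℝ → ℝ)
    (G : Graph C) (κ : GAtom C → Set ℝ) : Prop :=
  ∀ Q, κ Q =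
    {x | Q ∈ A.goalAtoms ∧ x = ic Q} ∪
    {x | ∃ P i ax σ k p m, (P, i) ∈ G.chained ∧ A.Backchains i ax σ P ∧
      ax.body[k]? = some p ∧ Q = p.inst σ ∧ IsLeast (κ P) m ∧ x = ρ (m * w i k)} ∪
    {x | ∃ P, (P, Q) ∈ G.factored ∧ IsLeast (κ P) x}

/-- `v` is the value of weighted abduction for `G`: the sum, over the abduced nodes, of the minimum
of their costs. -/
def IsWAObj (A : Instance C) (ic : GAtom C → ℝ) (w : ℕ → ℕ → ℝ) (ρ : ℝ → ℝ)
    (G : Graph C) (v : ℝ) : Prop :=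
  ∃ (κ : GAtom C → Set ℝ) (m : GAtom C → ℝ), IsCostLabelling A ic w ρ G κ ∧
    (G.abducedNodes A).Finite ∧ (∀ a ∈ G.abducedNodes A, IsLeast (κ a) (m a)) ∧
    v = ∑ᶠ a ∈ G.abducedNodes A, m a

/-- The weights `1.2 / r` of the `r` body atoms of an axiom. -/
noncomputable def uniformWeight (A : Instance C) (i _k : ℕ) : ℝ :=
  match A.axioms[i]? with
  | some ax => (6 / 5) / (ax.body.length : ℝ)
  | none => 0

/-- Rounding down to an integer, with minimum `1`. -/
noncomputable def roundCost (x : ℝ) : ℝ := max (⌊x⌋ : ℝ) 1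

/-! ## Ground answer set programs -/

section ASP

variable {T : Type u} {α : Type u}

/-- Ground body literals over terms `T` and atoms `α`. In an aggregate `x = #min {…}` or
`x = #max {…}`, an element `(t, as)` stands for `t : as`, and for `t` if `as` is empty. -/
inductive Lit (T : Type u) (α : Type u) : Type u
  | pos (a : α)
  | naf (a : α)
  | aggMin (x : T) (E : Set (T × List α))
  | aggMax (x : T) (E : Set (T × List α))

/-- The terms of those elements of an aggregate whose conditions hold in `I`. -/
def aggValues (I : Set α) (E : Set (T × List α)) : Set T :=
  {t | ∃ conds, (t, conds) ∈ E ∧ ∀ a ∈ conds, a ∈ I}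

/-- Truth of a literal in an interpretation; `lt` is the order of ground terms. -/
def Lit.Sat (lt : T → T → Prop) (I : Set α) : Lit T α → Prop
  | .pos a => a ∈ I
  | .naf a => a ∉ I
  | .aggMin x E => x ∈ aggValues I E ∧ ∀ y ∈ aggValues I E, ¬ lt y x
  | .aggMax x E => x ∈ aggValues I E ∧ ∀ y ∈ aggValues I E, ¬ lt x y

/-- Truth of a conjunction of literals. -/
def SatAll (lt : T → T → Prop) (I : Set α) (b : List (Lit T α)) : Prop :=
  ∀ x ∈ b, x.Sat lt I

/-- Rule heads: a disjunction (empty for a constraint), or a choice `lo ≤ { a : conds ; … } ≤ hi`. -/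
inductive Head (T : Type u) (α : Type u) : Type u
  | disj (as : List α)
  | choice (lo hi : ℕ∞) (E : Set (α × List (Lit T α)))

/-- A ground rule `head ← body`. -/
structure Rule (T : Type u) (α : Type u) : Type u where
  head : Head T α
  body : List (Lit T α)

/-- If the body of a choice rule holds in `I`, then the number of chosen atoms obeys the bounds. -/
def Rule.Bounds (lt : T → T → Prop) (I : Set α) (r : Rule T α) : Prop :=
  match r.head with
  | .disj _ => True
  | .choice lo hi E => SatAll lt I r.body →
      lo ≤ {a | a ∈ I ∧ ∃ conds, (a, conds) ∈ E ∧ SatAll lt I conds}.encard ∧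
      {a | a ∈ I ∧ ∃ conds, (a, conds) ∈ E ∧ SatAll lt I conds}.encard ≤ hi

/-- `J` satisfies what the FLP-reduct with respect to `I` retains of the rule: a disjunctive rule is
kept iff its body holds in `I`. A choice rule `{ a : conds ; … } ← body` stands for the rules
`a ∨ a' ← body, conds` with a fresh complement `a'` of `a`; after elimination of the complements,
the reduct keeps `a ← body, conds` iff `body`, `conds` and `a` hold in `I`. -/
def Rule.ReductSat (lt : T → T → Prop) (I : Set α) (r : Rule T α) (J : Set α) : Prop :=
  match r.head with
  | .disj as => SatAll lt I r.body → SatAll lt J r.body → ∃ a ∈ as, a ∈ J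
  | .choice _ _ E => ∀ a conds, (a, conds) ∈ E → SatAll lt I r.body → SatAll lt I conds → a ∈ I →
      SatAll lt J r.body → SatAll lt J conds → a ∈ J

/-- A ground weak constraint `:~ body. [weight@1, tuple]`. -/
structure WeakConstraint (T : Type u) (α : Type u) : Type u where
  body : List (Lit T α)
  weight : ℤ
  tuple : List T

/-- A ground program: rules and weak constraints. -/
structure Program (T : Type u) (α : Type u) : Type u where
  rules : Set (Rule T α)
  weak : Set (WeakConstraint T α)

/-- The union of two programs. -/
def Program.union (P Q : Program T α) : Program T α :=
  ⟨P.rules ∪ Q.rules, P.weak ∪ Q.weak⟩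

/-- `I` is an answer set: it obeys the bounds of choices and is a minimal model of the reduct. -/
def IsAnswerSet (lt : T → T → Prop) (P : Program T α) (I : Set α) : Prop :=
  (∀ r ∈ P.rules, r.Bounds lt I) ∧
  (∀ r ∈ P.rules, r.ReductSat lt I I) ∧
  ∀ J, J ⊂ I → ¬ ∀ r ∈ P.rules, r.ReductSat lt I J

/-- The distinct pairs of weight and tuple of the weak constraints whose body holds in `I`. -/
def violations (lt : T → T → Prop) (P : Program T α) (I : Set α) : Set (ℤ × List T) :=
  {e | ∃ wc ∈ P.weak, SatAll lt I wc.body ∧ e = (wc.weight, wc.tuple)}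

/-- The cost of an interpretation (meaningful if there are finitely many violations). -/
noncomputable def answerCost (lt : T → T → Prop) (P : Program T α) (I : Set α) : ℤ :=
  ∑ᶠ e ∈ violations lt P I, e.1

/-- The rule `a ← body`. -/
def rule (a : α) (body : List (Lit T α)) : Rule T α := ⟨.disj [a], body⟩

/-- The constraint `← body`. -/
def constraint (body : List (Lit T α)) : Rule T α := ⟨.disj [], body⟩

end ASP

/-! ## The encoding

Each nonground rule is given by the set of its ground instances over all ground terms; comparisons
and arithmetic are evaluated during instantiation. -/

/-- The ground atoms of the encoding (`tru` is the predicate `true`). -/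
inductive EAtom (C : Type u) : Type u
  | goal (P : Term C)
  | sortname (X : Term C)
  | pot (P : Term C)
  | mayInferVia (R P L : Term C)
  | inferenceNeeds (P R Q : Term C)
  | tru (P : Term C)
  | infer (P : Term C)
  | fai (P : Term C)
  | inferVia (R P : Term C)
  | hu (X : Term C)
  | uhu (X : Term C)
  | eq (X Y : Term C)
  | fa (P : Term C)
  | factorCluster (P Q : Term C)
  | factorClusterAbove (P : Term C)
  | factorVia (P Q : Term C)
  | factor (P : Term C)
  | abduce (P : Term C)
  | reach (Q P : Term C)
  | reachFromBoth (P Q : Term C)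
  | numberOfBodies (R N : Term C)
  | pcost (P X : Term C)
  | cost (P X : Term C)

/-- Rules of the encoding. -/
abbrev ERule (C : Type u) := Rule (Term C) (EAtom C)

/-- Programs of the encoding. -/
abbrev EProgram (C : Type u) := Program (Term C) (EAtom C)

open EAtom Lit

/-- The rewriting of axioms, goal and sort names. -/
def rulesBOS (A : Instance C) : Set (ERule C) :=
  {r | ∃ a ax σ, A.axioms[a]? = some ax ∧
    (∀ z ∈ ax.bodyOnlyVars, σ z = Term.sk a z (ax.head.inst σ).args) ∧
    r = rule (mayInferVia (.rid a) (ax.head.inst σ).enc (.l (ax.bodyOnlyVars.map σ)))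
      [pos (pot (ax.head.inst σ).enc)]} ∪
  {r | ∃ a ax σ, A.axioms[a]? = some ax ∧ ∃ p ∈ ax.body,
    r = rule (inferenceNeeds (ax.head.inst σ).enc (.rid a) (p.inst σ).enc)
      [pos (mayInferVia (.rid a) (ax.head.inst σ).enc (.l (ax.bodyOnlyVars.map σ)))]} ∪
  {r | ∃ P ∈ A.goalAtoms, r = rule (goal P.enc) []} ∪
  {r | ∃ s ∈ A.sorts, r = rule (sortname (.const s)) []}

/-- The maximal potential proof graph. -/
def rulesBPT (A : Instance C) : Set (ERule C) :=
  rulesBOS A ∪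
  {r | ∃ X, r = rule (pot X) [pos (goal X)]} ∪
  {r | ∃ P R Q, r = rule (pot Q) [pos (inferenceNeeds P R Q)]}

/-- The guess of the active part of the proof graph. -/
def rulesGP : Set (ERule C) :=
  {r | ∃ P, r = rule (tru P) [pos (goal P)]} ∪
  {r | ∃ P, r = ⟨.choice 1 1 {(infer P, []), (fai P, [])}, [pos (tru P)]⟩} ∪
  {r | ∃ P, r = ⟨.choice 1 1 {e | ∃ R L, e = (inferVia R P, [pos (mayInferVia R P L)])},
    [pos (infer P)]⟩} ∪
  {r | ∃ P R Q, r = rule (tru Q) [pos (inferVia R P), pos (inferenceNeeds P R Q)]}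

/-- The guess of an equivalence relation, for atoms of arbitrary arities. -/
def rulesEQ : Set (ERule C) :=
  {r | ∃ p ts, ∃ X ∈ ts, r = rule (hu X) [pos (pot (.c p ts))]} ∪
  {r | ∃ X, r = rule (uhu X) [pos (hu X), naf (sortname X)]} ∪
  {⟨.choice 0 ⊤ {e | ∃ X Y, X ≠ Y ∧ e = (eq X Y, [pos (uhu X), pos (uhu Y)])}, []⟩} ∪
  {r | ∃ X, r = rule (eq X X) [pos (hu X)]} ∪
  {r | ∃ X Y, r = constraint [pos (eq X Y), naf (eq Y X)]} ∪
  {r | ∃ X Y Z, X ≠ Y ∧ Y ≠ Z ∧ X ≠ Z ∧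
    r = constraint [pos (eq X Y), pos (eq Y Z), naf (eq X Z)]}

/-- Factoring of clusters with their smallest element, for atoms of arbitrary arities. -/
def rulesCluster (lt : Term C → Term C → Prop) : Set (ERule C) :=
  {r | ∃ P, r = rule (fa P) [pos (fai P)]} ∪
  {r | ∃ p ss ts, ss.length = ts.length ∧ lt (.c p ss) (.c p ts) ∧
    r = rule (factorCluster (.c p ts) (.c p ss))
      ([pos (fa (.c p ss)), pos (fa (.c p ts))] ++
        List.zipWith (fun X Y => pos (eq X Y)) ss ts)} ∪
  {r | ∃ X Y, r = rule (factorClusterAbove X) [pos (factorCluster X Y)]} ∪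
  {r | ∃ X Y, r = rule (factorVia X Y) [pos (factorCluster X Y), naf (factorClusterAbove Y)]} ∪
  {r | ∃ P Q, r = rule (factor P) [pos (factorVia P Q)]} ∪
  {r | ∃ P, r = rule (abduce P) [pos (fa P), naf (factor P)]}

/-- The encoding BWD-A. -/
def progBwda (A : Instance C) (lt : Term C → Term C → Prop) : EProgram C :=
  ⟨rulesBPT A ∪ rulesGP ∪ rulesEQ ∪ rulesCluster lt, ∅⟩

/-- The module for cardinality minimality. -/
def progCard : EProgram C :=
  ⟨∅, {k | ∃ P, k = ⟨[pos (abduce P)], 1, [P]⟩}⟩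

/-- The module for coherence. -/
def progCoh (lt : Term C → Term C → Prop) : EProgram C :=
  ⟨{r | ∃ P, r = rule (reach P P) [pos (goal P)]} ∪
    {r | ∃ P F R Q, r = rule (reach Q F)
      [pos (reach P F), pos (inferVia R P), pos (inferenceNeeds P R Q)]} ∪
    {r | ∃ P F Q, r = rule (reach Q F) [pos (reach P F), pos (factorVia P Q)]} ∪
    {r | ∃ P Q N, lt P Q ∧ r = rule (reachFromBoth P Q)
      [pos (goal P), pos (goal Q), pos (reach N P), pos (reach N Q)]},
   {k | ∃ P Q, lt P Q ∧ k = ⟨[pos (goal P), pos (goal Q), naf (reachFromBoth P Q)], 1, [P, Q]⟩}⟩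

/-- The module for weighted abduction, with the facts on the number of body atoms of each axiom. -/
def progWA (A : Instance C) : EProgram C :=
  ⟨{r | ∃ a ax, A.axioms[a]? = some ax ∧
      r = rule (numberOfBodies (.rid a) (.int ax.body.length)) []} ∪
    {r | ∃ P, r = rule (pcost P (.int 100)) [pos (goal P)]} ∪
    {r | ∃ P R Q M, ∃ x n : ℤ, n ≠ 0 ∧ r = rule (pcost Q M)
      [pos (inferVia R P), pos (inferenceNeeds P R Q),
        aggMax M {(.int ((x * 6 / 5) / n), []), (.int 1, [])},
        pos (pcost P (.int x)), pos (numberOfBodies R (.int n))]} ∪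
    {r | ∃ P Q X, r = rule (pcost Q X) [pos (factorVia P Q), pos (pcost P X)]} ∪
    {r | ∃ P X, r = rule (cost P X)
      [pos (abduce P), aggMin X {e | ∃ Y, e = (Y, [pcost P Y])}]},
   {k | ∃ P, ∃ n : ℤ, k = ⟨[pos (cost P (.int n))], n, [P]⟩}⟩

/-- The graph `G` is represented in `I`: its nodes by `true`, its back-chained atoms by `infervia`,
its factored atoms by `factorvia`, its edges by `infervia` with `inferenceneeds` and by
`factorvia`. -/
def Represents (A : Instance C) (I : Set (EAtom C)) (G : Graph C) : Prop :=
  (∀ t, tru t ∈ I ↔ ∃ P ∈ G.nodes, t = P.enc) ∧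
  (∀ t s, inferVia t s ∈ I ↔ ∃ P i, (P, i) ∈ G.chained ∧ t = Term.rid i ∧ s = P.enc) ∧
  (∀ s t, factorVia s t ∈ I ↔ ∃ P Q, (P, Q) ∈ G.factored ∧ s = P.enc ∧ t = Q.enc) ∧
  (∀ s t, ((∃ R, inferVia R t ∈ I ∧ inferenceNeeds t R s ∈ I) ∨ factorVia t s ∈ I) ↔
    ∃ Q P, G.Edge A Q P ∧ s = Q.enc ∧ t = P.enc)

end AbdASP

namespace AbdASP

universe u

/-! ## Answer sets: support and induction -/

section ASP

variable {T α : Type u} {lt : T → T → Prop} {P : Program T α} {I J : Set α}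

/-! Minimality of an answer set `I` among the models of its reduct is an induction principle: if `I
∩ S` models the reduct, then `I ⊆ S`. For this encoding it suffices that `S` contains each atom of
`I` heading a rule whose positive body holds in `I ∩ S` and whose other literals hold in `I`
(`IsAnswerSet.subset_of_supported`). Taking for `S` the complement of one atom shows that each atom
has a supporting rule, which turns the nonrecursive predicates into equivalences. Other choices of
`S` give inductions for the recursive predicates `true`, `reach` and `pcost`.

The proof graph is read off from `I`. The target of a factoring is the least atom of its cluster and
is not back-chained, so it has no incoming edge. A cycle would therefore consist of back-chainings
only and project to a cycle of axioms. Acyclicity of the axioms also makes the set of nodes finite: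
each back-chaining adds finitely many atoms, and chains of back-chainings follow `Feeds`. A
derivation of the hypothesis performs all back-chainings, in an order that exists because `true` is
founded in the goal, and then all factorings.

For each module, the violations are an injective image of the set over which the objective sums. For
cardinality and coherence this needs that `abduce` marks the nodes without incoming edge and that
`reach` is reachability from nodes to goal atoms. For weighted abduction, `pcost` passes on every
cost of a parent, while a cost labelling passes on only the least one. Rounding and multiplication
by a nonnegative weight are monotone, so both have the same minima (`isLeast_costStep_iff`).
Induction over the finite acyclic graph then shows that every labelling has these minima
(`isLeast_of_isCostLabelling`). -/

theorem satAll_nil : SatAll lt I [] ↔ True := by simp [SatAll]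

theorem satAll_cons {x : Lit T α} {b : List (Lit T α)} :
    SatAll lt I (x :: b) ↔ x.Sat lt I ∧ SatAll lt I b := by simp [SatAll]

theorem sat_pos {a : α} : (Lit.pos a : Lit T α).Sat lt I ↔ a ∈ I := Iff.rfl

theorem sat_naf {a : α} : (Lit.naf a : Lit T α).Sat lt I ↔ a ∉ I := Iff.rfl

theorem reductSat_rule {a : α} {b : List (Lit T α)} :
    (rule a b).ReductSat lt I J ↔ (SatAll lt I b → SatAll lt J b → a ∈ J) := by
  simp [Rule.ReductSat, rule]

theorem reductSat_constraint {b : List (Lit T α)} :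
    (constraint b).ReductSat lt I J ↔ (SatAll lt I b → ¬ SatAll lt J b) := by
  simp [Rule.ReductSat, constraint]

/-- Induction principle for the atoms of an answer set, from the minimality among the models of the
reduct. -/
theorem IsAnswerSet.subset_of_reductSat (h : IsAnswerSet lt P I) (S : Set α)
    (hS : ∀ r ∈ P.rules, r.ReductSat lt I (I ∩ S)) : I ⊆ S := by
  by_contra hn
  refine h.2.2 (I ∩ S) ⟨Set.inter_subset_left, fun hs => hn fun a ha => (hs ha).2⟩ hS

theorem satAll_zipWith_pos {β γ : Type*} (f : β → γ → α) {l : List β} {l' : List γ}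
    (hl : l.length = l'.length) :
    SatAll lt I (List.zipWith (fun x y => Lit.pos (f x y)) l l') ↔
      List.Forall₂ (fun x y => f x y ∈ I) l l' := by
  induction l generalizing l' with
  | nil => cases l' <;> simp_all [SatAll]
  | cons x l ih =>
    cases l' with
    | nil => simp at hl
    | cons y l' => simp only [List.zipWith_cons_cons, satAll_cons, sat_pos, List.forall₂_cons,
        ih (Nat.succ.inj hl)]

end ASP

variable {C : Type u} {A : Instance C} {lt : Term C → Term C → Prop} {I J : Set (EAtom C)}

open EAtom Lit

/-! ## Support in the encoding -/

/-- All rules of the encoding with all modules. -/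
def allRules (A : Instance C) (lt : Term C → Term C → Prop) : Set (ERule C) :=
  (progBwda A lt).rules ∪ (progCoh lt).rules ∪ (progWA A).rules

/-- `Supported A lt I J a`: some rule with `a` in its head has a body whose positive part holds in
`J` and whose remaining literals hold in `I`. -/
inductive Supported (A : Instance C) (lt : Term C → Term C → Prop) (I J : Set (EAtom C)) :
    EAtom C → Prop
  | goal {P} : P ∈ A.goalAtoms → Supported A lt I J (goal P.enc)
  | sortname {s} : s ∈ A.sorts → Supported A lt I J (sortname (.const s))
  | mayInferVia {a ax σ} : A.axioms[a]? = some ax →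
      (∀ z ∈ ax.bodyOnlyVars, σ z = Term.sk a z (ax.head.inst σ).args) →
      pot (ax.head.inst σ).enc ∈ J →
      Supported A lt I J
        (mayInferVia (.rid a) (ax.head.inst σ).enc (.l (ax.bodyOnlyVars.map σ)))
  | inferenceNeeds {a ax σ p} : A.axioms[a]? = some ax → p ∈ ax.body →
      mayInferVia (.rid a) (ax.head.inst σ).enc (.l (ax.bodyOnlyVars.map σ)) ∈ J →
      Supported A lt I J (inferenceNeeds (ax.head.inst σ).enc (.rid a) (p.inst σ).enc)
  | pot_goal {X} : goal X ∈ J → Supported A lt I J (pot X)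
  | pot_needs {P R Q} : inferenceNeeds P R Q ∈ J → Supported A lt I J (pot Q)
  | tru_goal {X} : goal X ∈ J → Supported A lt I J (tru X)
  | tru_needs {P R Q} : inferVia R P ∈ J → inferenceNeeds P R Q ∈ J → Supported A lt I J (tru Q)
  | infer {P} : tru P ∈ J → Supported A lt I J (infer P)
  | fai {P} : tru P ∈ J → Supported A lt I J (fai P)
  | inferVia {R P L} : infer P ∈ J → mayInferVia R P L ∈ J → Supported A lt I J (inferVia R P)
  | hu {p ts X} : X ∈ ts → pot (.c p ts) ∈ J → Supported A lt I J (hu X)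
  | uhu {X} : hu X ∈ J → sortname X ∉ I → Supported A lt I J (uhu X)
  | eq {X Y} : X ≠ Y → uhu X ∈ J → uhu Y ∈ J → Supported A lt I J (eq X Y)
  | eq_refl {X} : hu X ∈ J → Supported A lt I J (eq X X)
  | fa {P} : fai P ∈ J → Supported A lt I J (fa P)
  | factorCluster {p ss ts} : ss.length = ts.length → lt (.c p ss) (.c p ts) →
      fa (.c p ss) ∈ J → fa (.c p ts) ∈ J → List.Forall₂ (fun X Y => eq X Y ∈ J) ss ts →
      Supported A lt I J (factorCluster (.c p ts) (.c p ss))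
  | factorClusterAbove {X Y} : factorCluster X Y ∈ J → Supported A lt I J (factorClusterAbove X)
  | factorVia {X Y} : factorCluster X Y ∈ J → factorClusterAbove Y ∉ I →
      Supported A lt I J (factorVia X Y)
  | factor {P Q} : factorVia P Q ∈ J → Supported A lt I J (factor P)
  | abduce {P} : fa P ∈ J → factor P ∉ I → Supported A lt I J (abduce P)
  | reach_goal {P} : goal P ∈ J → Supported A lt I J (reach P P)
  | reach_needs {P F R Q} : reach P F ∈ J → inferVia R P ∈ J → inferenceNeeds P R Q ∈ J →
      Supported A lt I J (reach Q F)
  | reach_factor {P F Q} : reach P F ∈ J → factorVia P Q ∈ J → Supported A lt I J (reach Q F)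
  | reachFromBoth {P Q N} : lt P Q → goal P ∈ J → goal Q ∈ J → reach N P ∈ J → reach N Q ∈ J →
      Supported A lt I J (reachFromBoth P Q)
  | numberOfBodies {a ax} : A.axioms[a]? = some ax →
      Supported A lt I J (numberOfBodies (.rid a) (.int ax.body.length))
  | pcost_goal {P} : goal P ∈ J → Supported A lt I J (pcost P (.int 100))
  | pcost_needs {P R Q M} {x n : ℤ} : inferVia R P ∈ J → inferenceNeeds P R Q ∈ J →
      (aggMax M {(Term.int ((x * 6 / 5) / n), []), (Term.int 1, [])}).Sat lt I →
      pcost P (.int x) ∈ J → numberOfBodies R (.int n) ∈ J → Supported A lt I J (pcost Q M)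
  | pcost_factor {P Q X} : factorVia P Q ∈ J → pcost P X ∈ J → Supported A lt I J (pcost Q X)
  | cost {P X} : abduce P ∈ J → (aggMin X {e | ∃ Y, e = (Y, [pcost P Y])}).Sat lt I →
      Supported A lt I J (cost P X)

/-- `I` models its own reduct, so the head is in `I` as soon as the body holds; only membership in
`S` remains, and that comes from support. -/
theorem reductSat_inter_of_supported {S : Set (EAtom C)} {a : EAtom C}
    {b : List (Lit (Term C) (EAtom C))}
    (hS : ∀ a ∈ I, Supported A lt I (I ∩ S) a → a ∈ S) (hI : (rule a b).ReductSat lt I I)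
    (h : SatAll lt I b → SatAll lt (I ∩ S) b → Supported A lt I (I ∩ S) a) :
    (rule a b).ReductSat lt I (I ∩ S) := by
  rw [reductSat_rule] at hI ⊢
  exact fun h1 h2 => ⟨hI h1 h1, hS a (hI h1 h1) (h h1 h2)⟩

theorem IsAnswerSet.subset_of_supported {P : EProgram C} (h : IsAnswerSet lt P I)
    (hP : P.rules ⊆ allRules A lt) (S : Set (EAtom C))
    (hS : ∀ a ∈ I, Supported A lt I (I ∩ S) a → a ∈ S) : I ⊆ S := by
  refine h.subset_of_reductSat S fun r hr => ?_
  have hI := h.2.1 r hr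
  rcases hP hr with ((((((((((⟨a, ax, σ, ha, hσ, rfl⟩ | ⟨a, ax, σ, ha, p, hp, rfl⟩) |
    ⟨P, hP, rfl⟩) | ⟨s, hs, rfl⟩) | ⟨X, rfl⟩) | ⟨P, R, Q, rfl⟩) |
    (((⟨P, rfl⟩ | ⟨P, rfl⟩) | ⟨P, rfl⟩) | ⟨P, R, Q, rfl⟩)) |
    (((((⟨p, ts, X, hX, rfl⟩ | ⟨X, rfl⟩) | rfl) | ⟨X, rfl⟩) | ⟨X, Y, rfl⟩) |
      ⟨X, Y, Z, h1, h2, h3, rfl⟩)) |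
    (((((⟨P, rfl⟩ | ⟨p, ss, ts, hl, hlt, rfl⟩) | ⟨X, Y, rfl⟩) | ⟨X, Y, rfl⟩) | ⟨P, Q, rfl⟩) |
      ⟨P, rfl⟩)) |
    (((⟨P, rfl⟩ | ⟨P, F, R, Q, rfl⟩) | ⟨P, F, Q, rfl⟩) | ⟨P, Q, N, hlt, rfl⟩)) |
    ((((⟨a, ax, ha, rfl⟩ | ⟨P, rfl⟩) | ⟨P, R, Q, M, x, n, hn, rfl⟩) | ⟨P, Q, X, rfl⟩) |
      ⟨P, X, rfl⟩))
  · exact reductSat_inter_of_supported hS hI fun _ hJ => by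
      simp only [satAll_cons, sat_pos] at hJ; exact .mayInferVia ha hσ hJ.1
  · exact reductSat_inter_of_supported hS hI fun _ hJ => by
      simp only [satAll_cons, sat_pos] at hJ; exact .inferenceNeeds ha hp hJ.1
  · exact reductSat_inter_of_supported hS hI fun _ _ => .goal hP
  · exact reductSat_inter_of_supported hS hI fun _ _ => .sortname hs
  · exact reductSat_inter_of_supported hS hI fun _ hJ => by
      simp only [satAll_cons, sat_pos] at hJ; exact .pot_goal hJ.1
  · exact reductSat_inter_of_supported hS hI fun _ hJ => by
      simp only [satAll_cons, sat_pos] at hJ; exact .pot_needs hJ.1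
  · exact reductSat_inter_of_supported hS hI fun _ hJ => by
      simp only [satAll_cons, sat_pos] at hJ; exact .tru_goal hJ.1
  · intro a conds hE _ _ ha hJ _
    simp only [satAll_cons, sat_pos] at hJ
    refine ⟨ha, hS a ha ?_⟩
    rcases hE with hE | hE <;> cases hE
    · exact .infer hJ.1
    · exact .fai hJ.1
  · rintro a conds ⟨R, L, hE⟩ _ _ ha hJ hc
    cases hE
    simp only [satAll_cons, sat_pos] at hJ hc
    exact ⟨ha, hS _ ha (.inferVia hJ.1 hc.1)⟩
  · exact reductSat_inter_of_supported hS hI fun _ hJ => by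
      simp only [satAll_cons, sat_pos] at hJ; exact .tru_needs hJ.1 hJ.2.1
  · exact reductSat_inter_of_supported hS hI fun _ hJ => by
      simp only [satAll_cons, sat_pos] at hJ; exact .hu hX hJ.1
  · exact reductSat_inter_of_supported hS hI fun h1 hJ => by
      simp only [satAll_cons, sat_pos, sat_naf] at h1 hJ; exact .uhu hJ.1 h1.2.1
  · rintro a conds ⟨X, Y, hXY, hE⟩ _ _ ha hJ hc
    cases hE
    simp only [satAll_cons, sat_pos] at hc
    exact ⟨ha, hS _ ha (.eq hXY hc.1 hc.2.1)⟩
  · exact reductSat_inter_of_supported hS hI fun _ hJ => by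
      simp only [satAll_cons, sat_pos] at hJ; exact .eq_refl hJ.1
  -- The body of a constraint is false in `I`, so the reduct drops it.
  · exact reductSat_constraint.2 fun h1 _ => reductSat_constraint.1 hI h1 h1
  · exact reductSat_constraint.2 fun h1 _ => reductSat_constraint.1 hI h1 h1
  · exact reductSat_inter_of_supported hS hI fun _ hJ => by
      simp only [satAll_cons, sat_pos] at hJ; exact .fa hJ.1
  · exact reductSat_inter_of_supported hS hI fun _ hJ => by
      simp only [List.cons_append, List.nil_append, satAll_cons, sat_pos,
        satAll_zipWith_pos _ hl] at hJ
      exact .factorCluster hl hlt hJ.1 hJ.2.1 hJ.2.2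
  · exact reductSat_inter_of_supported hS hI fun _ hJ => by
      simp only [satAll_cons, sat_pos] at hJ; exact .factorClusterAbove hJ.1
  · exact reductSat_inter_of_supported hS hI fun h1 hJ => by
      simp only [satAll_cons, sat_pos, sat_naf] at h1 hJ; exact .factorVia hJ.1 h1.2.1
  · exact reductSat_inter_of_supported hS hI fun _ hJ => by
      simp only [satAll_cons, sat_pos] at hJ; exact .factor hJ.1
  · exact reductSat_inter_of_supported hS hI fun h1 hJ => by
      simp only [satAll_cons, sat_pos, sat_naf] at h1 hJ; exact .abduce hJ.1 h1.2.1
  · exact reductSat_inter_of_supported hS hI fun _ hJ => by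
      simp only [satAll_cons, sat_pos] at hJ; exact .reach_goal hJ.1
  · exact reductSat_inter_of_supported hS hI fun _ hJ => by
      simp only [satAll_cons, sat_pos] at hJ; exact .reach_needs hJ.1 hJ.2.1 hJ.2.2.1
  · exact reductSat_inter_of_supported hS hI fun _ hJ => by
      simp only [satAll_cons, sat_pos] at hJ; exact .reach_factor hJ.1 hJ.2.1
  · exact reductSat_inter_of_supported hS hI fun _ hJ => by
      simp only [satAll_cons, sat_pos] at hJ
      exact .reachFromBoth hlt hJ.1 hJ.2.1 hJ.2.2.1 hJ.2.2.2.1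
  · exact reductSat_inter_of_supported hS hI fun _ _ => .numberOfBodies ha
  · exact reductSat_inter_of_supported hS hI fun _ hJ => by
      simp only [satAll_cons, sat_pos] at hJ; exact .pcost_goal hJ.1
  · exact reductSat_inter_of_supported hS hI fun h1 hJ => by
      simp only [satAll_cons, sat_pos] at h1 hJ
      exact .pcost_needs hJ.1 hJ.2.1 h1.2.2.1 hJ.2.2.2.1 hJ.2.2.2.2.1
  · exact reductSat_inter_of_supported hS hI fun _ hJ => by
      simp only [satAll_cons, sat_pos] at hJ; exact .pcost_factor hJ.1 hJ.2.1
  · exact reductSat_inter_of_supported hS hI fun h1 hJ => by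
      simp only [satAll_cons, sat_pos] at h1 hJ; exact .cost hJ.1 h1.2.1

theorem Supported.mono {J' : Set (EAtom C)} (hJ : J ⊆ J') {a : EAtom C}
    (h : Supported A lt I J a) : Supported A lt I J' a := by
  cases h with
  | goal h => exact .goal h
  | sortname h => exact .sortname h
  | mayInferVia h1 h2 h3 => exact .mayInferVia h1 h2 (hJ h3)
  | inferenceNeeds h1 h2 h3 => exact .inferenceNeeds h1 h2 (hJ h3)
  | pot_goal h => exact .pot_goal (hJ h)
  | pot_needs h => exact .pot_needs (hJ h)
  | tru_goal h => exact .tru_goal (hJ h)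
  | tru_needs h1 h2 => exact .tru_needs (hJ h1) (hJ h2)
  | infer h => exact .infer (hJ h)
  | fai h => exact .fai (hJ h)
  | inferVia h1 h2 => exact .inferVia (hJ h1) (hJ h2)
  | hu h1 h2 => exact .hu h1 (hJ h2)
  | uhu h1 h2 => exact .uhu (hJ h1) h2
  | eq h1 h2 h3 => exact .eq h1 (hJ h2) (hJ h3)
  | eq_refl h => exact .eq_refl (hJ h)
  | fa h => exact .fa (hJ h)
  | factorCluster h1 h2 h3 h4 h5 =>
    exact .factorCluster h1 h2 (hJ h3) (hJ h4) (h5.imp fun _ _ h => hJ h)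
  | factorClusterAbove h => exact .factorClusterAbove (hJ h)
  | factorVia h1 h2 => exact .factorVia (hJ h1) h2
  | factor h => exact .factor (hJ h)
  | abduce h1 h2 => exact .abduce (hJ h1) h2
  | reach_goal h => exact .reach_goal (hJ h)
  | reach_needs h1 h2 h3 => exact .reach_needs (hJ h1) (hJ h2) (hJ h3)
  | reach_factor h1 h2 => exact .reach_factor (hJ h1) (hJ h2)
  | reachFromBoth h1 h2 h3 h4 h5 => exact .reachFromBoth h1 (hJ h2) (hJ h3) (hJ h4) (hJ h5)
  | numberOfBodies h => exact .numberOfBodies h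
  | pcost_goal h => exact .pcost_goal (hJ h)
  | pcost_needs h1 h2 h3 h4 h5 => exact .pcost_needs (hJ h1) (hJ h2) h3 (hJ h4) (hJ h5)
  | pcost_factor h1 h2 => exact .pcost_factor (hJ h1) (hJ h2)
  | cost h1 h2 => exact .cost (hJ h1) h2

/-- `I` obeys the rules of the encoding BWD-A, and each of its atoms is founded. -/
structure BaseModel (A : Instance C) (lt : Term C → Term C → Prop) (I : Set (EAtom C)) : Prop where
  bounds : ∀ r ∈ (progBwda A lt).rules, r.Bounds lt I
  closed : ∀ r ∈ (progBwda A lt).rules, r.ReductSat lt I I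
  founded : ∀ S : Set (EAtom C), (∀ a ∈ I, Supported A lt I (I ∩ S) a → a ∈ S) → I ⊆ S

theorem IsAnswerSet.baseModel {M : EProgram C}
    (h : IsAnswerSet lt ((progBwda A lt).union M) I)
    (hM : (progBwda A lt).rules ∪ M.rules ⊆ allRules A lt) : BaseModel A lt I :=
  ⟨fun r hr => h.1 r (Or.inl hr), fun r hr => h.2.1 r (Or.inl hr),
    fun S hS => h.subset_of_supported hM S hS⟩

theorem mem_of_rule {r : Set (ERule C)} (h : ∀ x ∈ r, x.ReductSat lt I I) {a : EAtom C}
    {b : List (Lit (Term C) (EAtom C))} (hr : rule a b ∈ r) (hb : SatAll lt I b) : a ∈ I :=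
  reductSat_rule.1 (h _ hr) hb hb

namespace BaseModel

variable (h : BaseModel A lt I)
include h

/-- Without a supporting rule for `a`, the complement of `{a}` would be closed and hence contain
`I`. -/
theorem supported {a : EAtom C} (ha : a ∈ I) : Supported A lt I I a := by
  by_contra hn
  have : I ⊆ {a}ᶜ := h.founded {a}ᶜ fun b hb hs hba => by
    rw [Set.mem_singleton_iff] at hba
    subst hba
    exact hn (hs.mono Set.inter_subset_left)
  exact this ha rfl

end BaseModel

/-! ## Substitutions and back-chaining -/

theorem GAtom.enc_injective : Function.Injective (GAtom.enc : GAtom C → Term C) := by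
  rintro ⟨p, ts⟩ ⟨q, ss⟩ h
  simpa [GAtom.enc] using h

theorem FAtom.mem_vars {p : FAtom C} {v : ℕ} : v ∈ p.vars ↔ Arg.var v ∈ p.args := by
  simp only [FAtom.vars, List.mem_filterMap]
  constructor
  · rintro ⟨a, ha, h⟩
    cases a <;> simp_all
  · exact fun h => ⟨_, h, rfl⟩

theorem FAtom.inst_congr {p : FAtom C} {σ τ : ℕ → Term C} (h : ∀ v ∈ p.vars, σ v = τ v) :
    p.inst σ = p.inst τ := by
  simp only [FAtom.inst, GAtom.mk.injEq, true_and, List.map_inj_left]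
  intro a ha
  cases a with
  | var v => exact h v (FAtom.mem_vars.2 ha)
  | const c => rfl

theorem FAtom.eq_of_inst_eq {p : FAtom C} {σ τ : ℕ → Term C} (h : p.inst σ = p.inst τ) {v : ℕ}
    (hv : v ∈ p.vars) : σ v = τ v := by
  simp only [FAtom.inst, GAtom.mk.injEq, true_and, List.map_inj_left] at h
  exact h _ (FAtom.mem_vars.1 hv)

/-- A body variable occurs in the head, where the ground head fixes its value, or is one of
`bodyOnlyVars`. -/
theorem HornAxiom.inst_body_eq {ax : HornAxiom C} {σ τ : ℕ → Term C}
    (hhead : ax.head.inst σ = ax.head.inst τ) (hbody : ∀ z ∈ ax.bodyOnlyVars, σ z = τ z)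
    {p : FAtom C} (hp : p ∈ ax.body) : p.inst σ = p.inst τ := by
  refine FAtom.inst_congr fun v hv => ?_
  by_cases hvh : v ∈ ax.head.vars
  · exact FAtom.eq_of_inst_eq hhead hvh
  · refine hbody v ?_
    simp only [HornAxiom.bodyOnlyVars, List.mem_dedup, List.mem_filter, List.mem_flatMap,
      decide_eq_true_eq]
    exact ⟨⟨p, hp, hv⟩, hvh⟩

theorem Instance.Backchains.axiom_eq {i : ℕ} {ax bx : HornAxiom C} {σ τ : ℕ → Term C}
    {P : GAtom C} (h : A.Backchains i ax σ P) (h' : A.Backchains i bx τ P) : ax = bx :=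
  Option.some.inj (h.1.symm.trans h'.1)

/-- Thanks to the Skolem terms, the added atoms depend only on `P` and `i`, so different witnesses
`σ` may be exchanged. -/
theorem Instance.Backchains.inst_eq {i : ℕ} {ax : HornAxiom C} {σ τ : ℕ → Term C}
    {P : GAtom C} (h : A.Backchains i ax σ P) (h' : A.Backchains i ax τ P)
    {p : FAtom C} (hp : p ∈ ax.body) : p.inst σ = p.inst τ :=
  HornAxiom.inst_body_eq (h.2.1.trans h'.2.1.symm)
    (fun z hz => (h.2.2 z hz).trans (h'.2.2 z hz).symm) hp

theorem Instance.goalAtoms_finite (A : Instance C) : A.goalAtoms.Finite :=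
  (A.goal.finite_toSet.image fun o : FAtom C => o.inst Term.gvar).subset fun _ ⟨o, ho, h⟩ =>
    ⟨o, ho, h.symm⟩

/-- Induction over the axioms of an acyclic knowledge base, from the body atoms to the head. -/
theorem Instance.Acyclic.induction (hA : A.Acyclic) {p : ℕ → Prop}
    (hp : ∀ i, (∀ j, A.Feeds i j → p j) → p i) (i : ℕ) : p i := by
  let r : ℕ → ℕ → Prop := fun j i => Relation.TransGen A.Feeds i j
  have : IsStrictOrder ℕ r :=
    { irrefl := hA
      trans := fun _ _ _ h1 h2 => h2.trans h1 }
  -- A strict order is well-founded on a finite set, and `Feeds` relates only indices of actual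
  -- axioms.
  have hwf : {i | i < A.axioms.length}.WellFoundedOn r := (Set.finite_lt_nat _).wellFoundedOn
  have hlt : ∀ i, i < A.axioms.length → p i := fun i hi =>
    hwf.induction hi fun k _ ih => hp k fun j hj => ih j
      (by
        obtain ⟨_, _, _, h, _⟩ := hj
        exact (List.getElem?_eq_some_iff.1 h).1) (.single hj)
  exact hp i fun j ⟨_, _, _, h, _⟩ => hlt j (List.getElem?_eq_some_iff.1 h).1

/-! ## The atoms of a model of the encoding -/

namespace BaseModel

variable (h : BaseModel A lt I)
include h

theorem goal_iff {t : Term C} : goal t ∈ I ↔ ∃ P ∈ A.goalAtoms, t = P.enc := by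
  constructor
  · intro ht
    cases h.supported ht with
    | goal hP => exact ⟨_, hP, rfl⟩
  · rintro ⟨P, hP, rfl⟩
    exact mem_of_rule h.closed
      (Or.inl (Or.inl (Or.inl (Or.inl (Or.inl (Or.inl (Or.inr ⟨P, hP, rfl⟩))))))) (satAll_nil.2 ⟨⟩)

theorem goal_enc_iff {P : GAtom C} : goal P.enc ∈ I ↔ P ∈ A.goalAtoms := by
  rw [h.goal_iff]
  exact ⟨fun ⟨Q, hQ, e⟩ => GAtom.enc_injective e ▸ hQ, fun hP => ⟨P, hP, rfl⟩⟩

theorem sortname_mem {s : C} (hs : s ∈ A.sorts) : sortname (.const s) ∈ I :=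
  mem_of_rule h.closed
    (Or.inl (Or.inl (Or.inl (Or.inl (Or.inl (Or.inr ⟨s, hs, rfl⟩)))))) (satAll_nil.2 ⟨⟩)

theorem pot_of_goal {t : Term C} (ht : goal t ∈ I) : pot t ∈ I :=
  mem_of_rule h.closed (Or.inl (Or.inl (Or.inl (Or.inl (Or.inr ⟨t, rfl⟩)))))
    (by simpa only [satAll_cons, satAll_nil, sat_pos, and_true] using ht)

theorem pot_of_needs {P R Q : Term C} (ht : inferenceNeeds P R Q ∈ I) : pot Q ∈ I :=
  mem_of_rule h.closed (Or.inl (Or.inl (Or.inl (Or.inr ⟨P, R, Q, rfl⟩))))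
    (by simpa only [satAll_cons, satAll_nil, sat_pos, and_true] using ht)

theorem mayInferVia_iff {R P : Term C} : (∃ L, mayInferVia R P L ∈ I) ↔
    ∃ i ax σ Q, A.Backchains i ax σ Q ∧ R = .rid i ∧ P = Q.enc ∧ pot P ∈ I := by
  constructor
  · rintro ⟨L, ht⟩
    cases h.supported ht with
    | mayInferVia h1 h2 h3 => exact ⟨_, _, _, _, ⟨h1, rfl, h2⟩, rfl, rfl, h3⟩
  · rintro ⟨i, ax, σ, Q, ⟨h1, rfl, h3⟩, rfl, rfl, h4⟩
    exact ⟨_, mem_of_rule h.closed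
      (Or.inl (Or.inl (Or.inl (Or.inl (Or.inl (Or.inl (Or.inl (Or.inl
        ⟨i, ax, σ, h1, h3, rfl⟩))))))))
      (by simpa only [satAll_cons, satAll_nil, sat_pos, and_true] using h4)⟩

/-- The rule for `inferenceNeeds` has instances for all substitutions. Only the term `l(…)` in its
body, matched with a supported `mayInferVia`, forces the body-only variables to be Skolem terms. -/
theorem needs_iff {P R Q : Term C} : inferenceNeeds P R Q ∈ I ↔
    ∃ i ax σ P', A.Backchains i ax σ P' ∧ P = P'.enc ∧ R = .rid i ∧
      (∃ p ∈ ax.body, Q = (p.inst σ).enc) ∧ pot P ∈ I := by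
  constructor
  · intro ht
    cases h.supported ht with
    | @inferenceNeeds a ax σ p h1 h2 h3 =>
      have hs := h.supported h3
      generalize hP : (ax.head.inst σ).enc = P at hs
      generalize hL : ax.bodyOnlyVars.map σ = L at hs
      cases hs with
      | @mayInferVia _ bx τ h4 h5 h6 =>
        obtain rfl : ax = bx := Option.some.inj (h1.symm.trans h4)
        have hhead := GAtom.enc_injective hP
        rw [List.map_inj_left] at hL
        exact ⟨a, ax, τ, _, ⟨h1, rfl, h5⟩, rfl, rfl,
          ⟨p, h2, by rw [HornAxiom.inst_body_eq hhead hL h2]⟩, h6⟩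
  · rintro ⟨i, ax, σ, _, ⟨h1, rfl, h3⟩, rfl, rfl, ⟨p, hp, rfl⟩, h4⟩
    refine mem_of_rule h.closed (Or.inl (Or.inl (Or.inl (Or.inl (Or.inl (Or.inl (Or.inl (Or.inr
        ⟨i, ax, σ, h1, p, hp, rfl⟩)))))))) ?_
    simp only [satAll_cons, satAll_nil, sat_pos, and_true]
    exact mem_of_rule h.closed
      (Or.inl (Or.inl (Or.inl (Or.inl (Or.inl (Or.inl (Or.inl (Or.inl
        ⟨i, ax, σ, h1, h3, rfl⟩))))))))
      (by simpa only [satAll_cons, satAll_nil, sat_pos, and_true] using h4)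

/-! ### The guessed part of the potential proof graph -/

theorem tru_of_goal {t : Term C} (ht : goal t ∈ I) : tru t ∈ I :=
  mem_of_rule h.closed (Or.inl (Or.inl (Or.inr (Or.inl (Or.inl (Or.inl ⟨t, rfl⟩))))))
    (by simpa only [satAll_cons, satAll_nil, sat_pos, and_true] using ht)

theorem tru_of_needs {P R Q : Term C} (h1 : inferVia R P ∈ I) (h2 : inferenceNeeds P R Q ∈ I) :
    tru Q ∈ I :=
  mem_of_rule h.closed (Or.inl (Or.inl (Or.inr (Or.inr ⟨P, R, Q, rfl⟩))))
    (by simpa only [satAll_cons, satAll_nil, sat_pos, and_true] using ⟨h1, h2⟩)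

/-- `tru`, `infer` and `inferVia` depend on each other, so the founded set must carry `p` through
all three at once. -/
theorem tru_induction {p : Term C → Prop} (hgoal : ∀ t, goal t ∈ I → p t)
    (hneeds : ∀ P R Q, p P → inferVia R P ∈ I → inferenceNeeds P R Q ∈ I → p Q)
    {t : Term C} (ht : tru t ∈ I) : p t := by
  have := h.founded {a | (∀ t, a = tru t → p t) ∧ (∀ t, a = infer t → p t) ∧
    ∀ R t, a = inferVia R t → p t} fun a _ hs => by
      refine ⟨?_, ?_, ?_⟩
      · rintro t rfl
        cases hs with
        | tru_goal h1 => exact hgoal _ h1.1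
        | tru_needs h1 h2 => exact hneeds _ _ _ (h1.2.2.2 _ _ rfl) h1.1 h2.1
      · rintro t rfl
        cases hs with
        | infer h1 => exact h1.2.1 _ rfl
      · rintro R t rfl
        cases hs with
        | inferVia h1 _ => exact h1.2.2.1 _ rfl
  exact (this ht).1 t rfl

theorem pot_of_tru {t : Term C} (ht : tru t ∈ I) : pot t ∈ I :=
  h.tru_induction (p := fun t => pot t ∈ I) (fun _ => h.pot_of_goal)
    (fun _ _ _ _ _ hn => h.pot_of_needs hn) ht

theorem exists_of_tru {t : Term C} (ht : tru t ∈ I) : ∃ P : GAtom C, t = P.enc := by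
  cases h.supported ht with
  | tru_goal hg =>
    obtain ⟨P, _, rfl⟩ := h.goal_iff.1 hg
    exact ⟨P, rfl⟩
  | tru_needs _ hn =>
    obtain ⟨_, _, _, _, _, _, _, ⟨_, _, rfl⟩, _⟩ := h.needs_iff.1 hn
    exact ⟨_, rfl⟩

theorem tru_of_infer {t : Term C} (ht : infer t ∈ I) : tru t ∈ I := by
  cases h.supported ht with | infer ht => exact ht

theorem tru_of_fai {t : Term C} (ht : fai t ∈ I) : tru t ∈ I := by
  cases h.supported ht with | fai ht => exact ht

theorem infer_of_inferVia {R t : Term C} (ht : inferVia R t ∈ I) : infer t ∈ I := by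
  cases h.supported ht with | inferVia ht _ => exact ht

theorem inferVia_iff_exists {R t : Term C} (ht : inferVia R t ∈ I) :
    ∃ i ax σ P, A.Backchains i ax σ P ∧ R = .rid i ∧ t = P.enc := by
  cases h.supported ht with
  | inferVia _ hm =>
    obtain ⟨i, ax, σ, Q, h1, h2, h3, _⟩ := h.mayInferVia_iff.1 ⟨_, hm⟩
    exact ⟨i, ax, σ, Q, h1, h2, h3⟩

theorem infer_or_fai {t : Term C} (ht : tru t ∈ I) : infer t ∈ I ∨ fai t ∈ I := by
  have hb := (h.bounds _ (Or.inl (Or.inl (Or.inr (Or.inl (Or.inl (Or.inr ⟨t, rfl⟩)))))))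
    (by simpa only [satAll_cons, satAll_nil, sat_pos, and_true] using ht)
  obtain ⟨a, ha, conds, hE, _⟩ := Set.one_le_encard_iff_nonempty.1 hb.1
  rcases hE with hE | hE <;> cases hE
  exacts [.inl ha, .inr ha]

theorem not_infer_of_fai {t : Term C} (ht : fai t ∈ I) : infer t ∉ I := by
  intro hi
  have hb := (h.bounds _ (Or.inl (Or.inl (Or.inr (Or.inl (Or.inl (Or.inr ⟨t, rfl⟩)))))))
    (by simpa only [satAll_cons, satAll_nil, sat_pos, and_true] using h.tru_of_fai ht)
  have := Set.encard_le_one_iff.1 hb.2 (infer t) (fai t)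
    ⟨hi, [], Or.inl rfl, satAll_nil.2 ⟨⟩⟩ ⟨ht, [], Or.inr rfl, satAll_nil.2 ⟨⟩⟩
  cases this

theorem exists_inferVia {t : Term C} (ht : infer t ∈ I) : ∃ R, inferVia R t ∈ I := by
  have hb := (h.bounds _ (Or.inl (Or.inl (Or.inr (Or.inl (Or.inr ⟨t, rfl⟩))))))
    (by simpa only [satAll_cons, satAll_nil, sat_pos, and_true] using ht)
  obtain ⟨a, ha, conds, ⟨R, L, hE⟩, _⟩ := Set.one_le_encard_iff_nonempty.1 hb.1
  cases hE
  exact ⟨R, ha⟩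

theorem inferVia_unique {R R' t : Term C} (h1 : inferVia R t ∈ I) (h2 : inferVia R' t ∈ I) :
    R = R' := by
  have hb := (h.bounds _ (Or.inl (Or.inl (Or.inr (Or.inl (Or.inr ⟨t, rfl⟩))))))
    (by simpa only [satAll_cons, satAll_nil, sat_pos, and_true] using h.infer_of_inferVia h1)
  have key : ∀ R, inferVia R t ∈ I → ∃ L, mayInferVia R t L ∈ I := fun R hR => by
    cases h.supported hR with | inferVia _ hm => exact ⟨_, hm⟩
  obtain ⟨L, hL⟩ := key R h1
  obtain ⟨L', hL'⟩ := key R' h2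
  have := Set.encard_le_one_iff.1 hb.2 (inferVia R t) (inferVia R' t)
    ⟨h1, _, ⟨R, L, rfl⟩, by simpa only [satAll_cons, satAll_nil, sat_pos, and_true] using hL⟩
    ⟨h2, _, ⟨R', L', rfl⟩, by simpa only [satAll_cons, satAll_nil, sat_pos, and_true] using hL'⟩
  exact (EAtom.inferVia.inj this).1

theorem fa_iff {t : Term C} : fa t ∈ I ↔ fai t ∈ I := by
  constructor
  · intro ht
    cases h.supported ht with | fa ht => exact ht
  · intro ht
    exact mem_of_rule h.closed (Or.inr (Or.inl (Or.inl (Or.inl (Or.inl (Or.inl ⟨t, rfl⟩))))))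
      (by simpa only [satAll_cons, satAll_nil, sat_pos, and_true] using ht)

/-! ### The guessed equivalence relation -/

theorem eq_refl_mem {X : Term C} (hX : hu X ∈ I) : eq X X ∈ I :=
  mem_of_rule h.closed (Or.inl (Or.inr (Or.inl (Or.inl (Or.inr ⟨X, rfl⟩)))))
    (by simpa only [satAll_cons, satAll_nil, sat_pos, and_true] using hX)

theorem eq_symm_mem {X Y : Term C} (hX : eq X Y ∈ I) : eq Y X ∈ I := by
  by_contra hn
  have := reductSat_constraint.1
    (h.closed _ (Or.inl (Or.inr (Or.inl (Or.inr ⟨X, Y, rfl⟩)))))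
  simp only [satAll_cons, satAll_nil, sat_pos, sat_naf] at this
  exact this ⟨hX, hn, ⟨⟩⟩ ⟨hX, hn, ⟨⟩⟩

theorem hu_of_eq {X Y : Term C} (hX : eq X Y ∈ I) : hu X ∈ I := by
  cases h.supported hX with
  | eq _ hu _ => cases h.supported hu with | uhu hu _ => exact hu
  | eq_refl hu => exact hu

/-- The transitivity constraint covers three distinct terms only; the case `X = Z` needs
reflexivity, hence `hu X`. -/
theorem eq_trans_mem {X Y Z : Term C} (h1 : eq X Y ∈ I) (h2 : eq Y Z ∈ I) : eq X Z ∈ I := by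
  by_cases hXY : X = Y
  · exact hXY ▸ h2
  by_cases hYZ : Y = Z
  · exact hYZ ▸ h1
  by_cases hXZ : X = Z
  · exact hXZ ▸ h.eq_refl_mem (h.hu_of_eq h1)
  by_contra hn
  have := reductSat_constraint.1
    (h.closed _ (Or.inl (Or.inr (Or.inr ⟨X, Y, Z, hXY, hYZ, hXZ, rfl⟩))))
  simp only [satAll_cons, satAll_nil, sat_pos, sat_naf] at this
  exact this ⟨h1, h2, hn, ⟨⟩⟩ ⟨h1, h2, hn, ⟨⟩⟩

/-- Only the choice rule supports an equation of distinct terms, and it ranges over `uhu`, which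
excludes sort names. -/
theorem notSort_of_eq {X Y : Term C} (hX : eq X Y ∈ I) (hne : X ≠ Y) : A.NotSort X := by
  intro s hs hXs
  cases h.supported hX with
  | eq _ hu _ =>
    cases h.supported hu with
    | uhu _ hn => exact hn (hXs ▸ h.sortname_mem hs)
  | eq_refl _ => exact hne rfl

/-! ### Clusters, factoring and abduction -/

theorem factorCluster_iff {s t : Term C} : factorCluster t s ∈ I ↔
    ∃ p ss ts, s = .c p ss ∧ t = .c p ts ∧ lt s t ∧ fa s ∈ I ∧ fa t ∈ I ∧
      List.Forall₂ (fun X Y => eq X Y ∈ I) ss ts := by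
  constructor
  · intro ht
    cases h.supported ht with
    | factorCluster h1 h2 h3 h4 h5 => exact ⟨_, _, _, rfl, rfl, h2, h3, h4, h5⟩
  · rintro ⟨p, ss, ts, rfl, rfl, h2, h3, h4, h5⟩
    have hl := h5.length_eq
    refine mem_of_rule h.closed
      (Or.inr (Or.inl (Or.inl (Or.inl (Or.inl (Or.inr ⟨p, ss, ts, hl, h2, rfl⟩)))))) ?_
    simp only [List.cons_append, List.nil_append, satAll_cons, sat_pos, satAll_zipWith_pos _ hl]
    exact ⟨h3, h4, h5⟩

theorem factorClusterAbove_iff {t : Term C} :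
    factorClusterAbove t ∈ I ↔ ∃ s, factorCluster t s ∈ I := by
  constructor
  · intro ht
    cases h.supported ht with | factorClusterAbove ht => exact ⟨_, ht⟩
  · rintro ⟨s, hs⟩
    exact mem_of_rule h.closed (Or.inr (Or.inl (Or.inl (Or.inl (Or.inr ⟨t, s, rfl⟩)))))
      (by simpa only [satAll_cons, satAll_nil, sat_pos, and_true] using hs)

theorem factorVia_iff {s t : Term C} :
    factorVia t s ∈ I ↔ factorCluster t s ∈ I ∧ factorClusterAbove s ∉ I := by
  constructor
  · intro ht
    cases h.supported ht with | factorVia h1 h2 => exact ⟨h1, h2⟩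
  · intro hs
    exact mem_of_rule h.closed (Or.inr (Or.inl (Or.inl (Or.inr ⟨t, s, rfl⟩))))
      (by simpa only [satAll_cons, satAll_nil, sat_pos, sat_naf, and_true] using hs)

theorem factor_iff {t : Term C} : factor t ∈ I ↔ ∃ s, factorVia t s ∈ I := by
  constructor
  · intro ht
    cases h.supported ht with | factor ht => exact ⟨_, ht⟩
  · rintro ⟨s, hs⟩
    exact mem_of_rule h.closed (Or.inr (Or.inl (Or.inr ⟨t, s, rfl⟩)))
      (by simpa only [satAll_cons, satAll_nil, sat_pos, and_true] using hs)

theorem abduce_iff {t : Term C} : abduce t ∈ I ↔ fa t ∈ I ∧ factor t ∉ I := by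
  constructor
  · intro ht
    cases h.supported ht with | abduce h1 h2 => exact ⟨h1, h2⟩
  · intro hs
    exact mem_of_rule h.closed (Or.inr (Or.inr ⟨t, rfl⟩))
      (by simpa only [satAll_cons, satAll_nil, sat_pos, sat_naf, and_true] using hs)

theorem fa_of_factorVia {s t : Term C} (ht : factorVia t s ∈ I) : fa t ∈ I ∧ fa s ∈ I := by
  obtain ⟨p, ss, ts, _, _, _, h3, h4, _⟩ := h.factorCluster_iff.1 (h.factorVia_iff.1 ht).1
  exact ⟨h4, h3⟩

theorem not_inferVia_of_fa {R t : Term C} (ht : fa t ∈ I) : inferVia R t ∉ I := fun hR =>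
  h.not_infer_of_fai (h.fa_iff.1 ht) (h.infer_of_inferVia hR)

theorem not_factorVia_of_factorVia {s t r : Term C} (ht : factorVia t s ∈ I) :
    factorVia s r ∉ I := fun hs =>
  (h.factorVia_iff.1 ht).2 (h.factorClusterAbove_iff.2 ⟨r, (h.factorVia_iff.1 hs).1⟩)

/-- If `t` is clustered with `s` and `s'`, then by symmetry and transitivity of `eq` the larger of
the two is clustered with the smaller, so it is not allowed as a target. -/
theorem factorVia_unique (hlt : IsStrictTotalOrder (Term C) lt) {s s' t : Term C}
    (hs : factorVia t s ∈ I) (hs' : factorVia t s' ∈ I) : s = s' := by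
  rw [h.factorVia_iff, h.factorClusterAbove_iff] at hs hs'
  have key : ∀ s s', factorCluster t s ∈ I → factorCluster t s' ∈ I → lt s' s →
      factorCluster s s' ∈ I := by
    intro s s' hs hs' hlt
    obtain ⟨p, ss, ts, rfl, rfl, _, h3, h4, h5⟩ := h.factorCluster_iff.1 hs
    obtain ⟨p', ss', ts', rfl, he, _, h3', h4', h5'⟩ := h.factorCluster_iff.1 hs'
    cases he
    refine h.factorCluster_iff.2 ⟨p, ss', ss, rfl, rfl, hlt, h3', h3, ?_⟩
    rw [List.forall₂_iff_get] at h5 h5' ⊢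
    refine ⟨h5'.1.trans h5.1.symm, fun i hi hi' => ?_⟩
    have hi'' : i < ts.length := h5.1 ▸ hi'
    exact h.eq_trans_mem (h5'.2 i hi hi'') (h.eq_symm_mem (h5.2 i hi' hi''))
  rcases hlt.toTrichotomous.rel_or_eq_or_rel_swap (a := s) (b := s') with hl | hl | hl
  · exact (hs'.2 ⟨_, key _ _ hs'.1 hs.1 hl⟩).elim
  · exact hl
  · exact (hs.2 ⟨_, key _ _ hs.1 hs'.1 hl⟩).elim

end BaseModel

/-! ## Derivations of hypotheses -/

/-- The atoms added by the back-chainings in `ch`. -/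
def chainedChildren (A : Instance C) (ch : Set (GAtom C × ℕ)) : Set (GAtom C) :=
  {Q | ∃ P i ax σ, (P, i) ∈ ch ∧ A.Backchains i ax σ P ∧ ∃ p ∈ ax.body, Q = p.inst σ}

/-- A finite set of back-chainings that are grounded in the goal can be performed in some order. -/
theorem derives_of_grounded {ch : Set (GAtom C × ℕ)} (hfin : ch.Finite)
    (hfun : ∀ P i j, (P, i) ∈ ch → (P, j) ∈ ch → i = j)
    (hbc : ∀ P i, (P, i) ∈ ch → ∃ ax σ, A.Backchains i ax σ P)
    (hground : ∀ bc ⊆ ch, (∀ P i, (P, i) ∈ ch → P ∈ A.goalAtoms ∪ chainedChildren A bc →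
      (P, i) ∈ bc) → ch ⊆ bc) :
    Derives A ⟨A.goalAtoms ∪ chainedChildren A ch, ∅⟩ ch ∅ := by
  have hempty : A.goalAtoms ∪ chainedChildren A ∅ = A.goalAtoms := by
    simp [chainedChildren]
  -- Take a maximal derivable subset. A missing back-chaining of an atom already present could be
  -- performed next, so maximality yields the closure that `hground` asks for.
  obtain ⟨bc, ⟨hsub, hder⟩, hmax⟩ := (hfin.finite_subsets.subset
    (t := {bc | bc ⊆ ch ∧ Derives A ⟨A.goalAtoms ∪ chainedChildren A bc, ∅⟩ bc ∅})
    fun _ hb => hb.1).exists_maximal ⟨∅, Set.empty_subset _, by rw [hempty]; exact .goal⟩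
  have hch : ch ⊆ bc := by
    refine hground bc hsub fun P i hP hPa => ?_
    by_contra hn
    obtain ⟨ax, σ, hb⟩ := hbc P i hP
    have hstep := Derives.backchain hder hPa
      ⟨fun j hj => hn (hfun P i j hP (hsub hj) ▸ hj), fun _ hQ => hQ⟩ hb
    refine hn (hmax ⟨Set.insert_subset hP hsub, ?_⟩ (Set.subset_insert _ _) (Set.mem_insert _ _))
    convert hstep using 2
    ext Q
    simp only [Set.mem_union, or_assoc, chainedChildren, Set.mem_ofPred_eq, Set.mem_insert_iff,
      Prod.mk.injEq]
    refine or_congr_right ⟨?_, ?_⟩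
    · rintro ⟨P', i', bx, τ, ⟨rfl, rfl⟩ | hm, hb', p, hp, rfl⟩
      · obtain rfl := hb.axiom_eq hb'
        exact .inr ⟨p, hp, hb'.inst_eq hb hp⟩
      · exact .inl ⟨P', i', bx, τ, hm, hb', p, hp, rfl⟩
    · rintro (⟨P', i', bx, τ, hm, hb', p, hp, rfl⟩ | ⟨p, hp, rfl⟩)
      · exact ⟨P', i', bx, τ, .inr hm, hb', p, hp, rfl⟩
      · exact ⟨P, i, ax, σ, .inl ⟨rfl, rfl⟩, hb, p, hp, rfl⟩
  rwa [hch.antisymm hsub]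

/-- A finite set of compatible factorings can be performed in any order. -/
theorem Derives.factorings {atoms : Set (GAtom C)} {ch : Set (GAtom C × ℕ)}
    {fc : Set (GAtom C × GAtom C)} (hder : Derives A ⟨atoms, ∅⟩ ch ∅) (hfin : fc.Finite)
    (hfc : ∀ P Q, (P, Q) ∈ fc → P ∈ atoms ∧ Q ∈ atoms ∧ P ≠ Q ∧ (∀ i, (P, i) ∉ ch) ∧
      A.Unifiable P Q)
    (hfun : ∀ P Q R, (P, Q) ∈ fc → (P, R) ∈ fc → Q = R) :
    Derives A ⟨atoms, {e | ∃ P Q, (P, Q) ∈ fc ∧ e ∈ unifEqs P Q}⟩ ch fc := by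
  -- Unification adds no atoms, so the conditions on atoms persist; `hfun` keeps each factored atom
  -- unjustified until its turn.
  refine Set.Finite.induction_on_subset (motive := fun fc' _ =>
    Derives A ⟨atoms, {e | ∃ P Q, (P, Q) ∈ fc' ∧ e ∈ unifEqs P Q}⟩ ch fc') fc hfin ?_ ?_
  · simpa using hder
  · rintro ⟨P, Q⟩ fc' hPQ hsub hn ih
    obtain ⟨h1, h2, h3, h4, h5⟩ := hfc P Q hPQ
    convert Derives.unify ih h1 h2 h3
      ⟨h4, fun R hR => hn (hfun P Q R hPQ (hsub hR) ▸ hR)⟩ h5 using 2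
    ext e
    simp only [Set.mem_ofPred_eq, Set.mem_insert_iff, Prod.mk.injEq, Set.mem_union]
    constructor
    · rintro ⟨P', Q', ⟨rfl, rfl⟩ | hm, he⟩
      exacts [.inr he, .inl ⟨_, _, hm, he⟩]
    · rintro (⟨P', Q', hm, he⟩ | he)
      exacts [⟨_, _, .inr hm, he⟩, ⟨P, Q, .inl ⟨rfl, rfl⟩, he⟩]

/-- The atoms that are reached from `P` by the back-chainings of `G`. -/
def Graph.chainedFrom (A : Instance C) (G : Graph C) (P : GAtom C) : Set (GAtom C) :=
  {Q | Relation.ReflTransGen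
    (fun P Q => ∃ i ax σ, (P, i) ∈ G.chained ∧ A.Backchains i ax σ P ∧ ∃ p ∈ ax.body,
      Q = p.inst σ) P Q}

/-- An atom that is not back-chained reaches only itself. -/
theorem Graph.chainedFrom_finite_of_forall {G : Graph C} {P : GAtom C}
    (hG : ∀ i, (P, i) ∈ G.chained → (G.chainedFrom A P).Finite) : (G.chainedFrom A P).Finite := by
  by_cases hc : ∃ i, (P, i) ∈ G.chained
  · exact hG _ hc.choose_spec
  · refine (Set.finite_singleton P).subset fun Q hQ => ?_
    rcases hQ.cases_head with rfl | ⟨R, ⟨i, _, _, hi, _⟩, _⟩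
    · rfl
    · exact (hc ⟨i, hi⟩).elim

/-! ## The proof graph of a model of the encoding -/

/-- The graph represented by an interpretation. -/
def graphOf (I : Set (EAtom C)) : Graph C where
  nodes := {P | tru P.enc ∈ I}
  chained := {e | inferVia (.rid e.2) e.1.enc ∈ I}
  factored := {e | factorVia e.1.enc e.2.enc ∈ I}

/-- The hypothesis represented by an interpretation. -/
def hypOf (I : Set (EAtom C)) : Hyp C where
  atoms := (graphOf I).nodes
  eqs := {e | ∃ P Q, (P, Q) ∈ (graphOf I).factored ∧ e ∈ unifEqs P Q}

namespace BaseModel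

variable (h : BaseModel A lt I)
include h

theorem exists_backchains {P : GAtom C} {i : ℕ} (hP : (P, i) ∈ (graphOf I).chained) :
    ∃ ax σ, A.Backchains i ax σ P := by
  obtain ⟨j, ax, σ, Q, hb, he, hQ⟩ := h.inferVia_iff_exists hP
  cases he
  obtain rfl := GAtom.enc_injective hQ
  exact ⟨ax, σ, hb⟩

theorem chained_unique {P : GAtom C} {i j : ℕ} (hi : (P, i) ∈ (graphOf I).chained)
    (hj : (P, j) ∈ (graphOf I).chained) : i = j :=
  Term.rid.inj (h.inferVia_unique hi hj)

theorem tru_of_inferVia {R t : Term C} (ht : inferVia R t ∈ I) : tru t ∈ I :=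
  h.tru_of_infer (h.infer_of_inferVia ht)

theorem mem_nodes_of_chained {P : GAtom C} {i : ℕ} (hP : (P, i) ∈ (graphOf I).chained) :
    P ∈ (graphOf I).nodes :=
  h.tru_of_inferVia hP

theorem mem_nodes_of_factored {P Q : GAtom C} (hP : (P, Q) ∈ (graphOf I).factored) :
    P ∈ (graphOf I).nodes ∧ Q ∈ (graphOf I).nodes :=
  ⟨h.tru_of_fai (h.fa_iff.1 (h.fa_of_factorVia hP).1),
    h.tru_of_fai (h.fa_iff.1 (h.fa_of_factorVia hP).2)⟩

theorem not_chained_of_factored {P Q : GAtom C} (hP : (P, Q) ∈ (graphOf I).factored) (i : ℕ) :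
    (P, i) ∉ (graphOf I).chained :=
  h.not_inferVia_of_fa (h.fa_of_factorVia hP).1

theorem needs_of_chained {P : GAtom C} {i : ℕ} {ax : HornAxiom C} {σ : ℕ → Term C}
    (hP : (P, i) ∈ (graphOf I).chained) (hb : A.Backchains i ax σ P) {p : FAtom C}
    (hp : p ∈ ax.body) : inferenceNeeds P.enc (.rid i) (p.inst σ).enc ∈ I :=
  h.needs_iff.2 ⟨i, ax, σ, P, hb, rfl, rfl, ⟨p, hp, rfl⟩, h.pot_of_tru (h.tru_of_inferVia hP)⟩

theorem chained_of_needs {R s t : Term C} (h1 : inferVia R t ∈ I)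
    (h2 : inferenceNeeds t R s ∈ I) : ∃ P i ax σ p, (P, i) ∈ (graphOf I).chained ∧
      A.Backchains i ax σ P ∧ p ∈ ax.body ∧ t = P.enc ∧ R = .rid i ∧ s = (p.inst σ).enc := by
  obtain ⟨i, ax, σ, P, hb, rfl, rfl, ⟨p, hp, rfl⟩, _⟩ := h.needs_iff.1 h2
  exact ⟨P, i, ax, σ, p, h1, hb, hp, rfl, rfl, rfl⟩

theorem exists_of_factorVia {s t : Term C} (ht : factorVia t s ∈ I) :
    ∃ P Q, (P, Q) ∈ (graphOf I).factored ∧ t = P.enc ∧ s = Q.enc := by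
  obtain ⟨h1, h2⟩ := h.fa_of_factorVia ht
  obtain ⟨P, rfl⟩ := h.exists_of_tru (h.tru_of_fai (h.fa_iff.1 h1))
  obtain ⟨Q, rfl⟩ := h.exists_of_tru (h.tru_of_fai (h.fa_iff.1 h2))
  exact ⟨P, Q, ht, rfl, rfl⟩

theorem edge_iff {s t : Term C} :
    ((∃ R, inferVia R t ∈ I ∧ inferenceNeeds t R s ∈ I) ∨ factorVia t s ∈ I) ↔
      ∃ Q P, (graphOf I).Edge A Q P ∧ s = Q.enc ∧ t = P.enc := by
  constructor
  · rintro (⟨R, h1, h2⟩ | hf)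
    · obtain ⟨P, i, ax, σ, p, hc, hb, hp, rfl, rfl, rfl⟩ := h.chained_of_needs h1 h2
      exact ⟨_, P, .inl ⟨i, ax, σ, hc, hb, p, hp, rfl⟩, rfl, rfl⟩
    · obtain ⟨P, Q, hf, rfl, rfl⟩ := h.exists_of_factorVia hf
      exact ⟨Q, P, .inr hf, rfl, rfl⟩
  · rintro ⟨_, P, ⟨i, ax, σ, hc, hb, p, hp, rfl⟩ | hf, rfl, rfl⟩
    · exact .inl ⟨_, hc, h.needs_of_chained hc hb hp⟩
    · exact .inr hf

theorem represents : Represents A I (graphOf I) := by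
  refine ⟨fun t => ⟨fun ht => ?_, ?_⟩, fun t s => ⟨fun ht => ?_, ?_⟩, fun s t => ⟨fun ht => ?_, ?_⟩,
    fun s t => h.edge_iff⟩
  · obtain ⟨P, rfl⟩ := h.exists_of_tru ht
    exact ⟨P, ht, rfl⟩
  · rintro ⟨P, hP, rfl⟩
    exact hP
  · obtain ⟨i, ax, σ, P, hb, rfl, rfl⟩ := h.inferVia_iff_exists ht
    exact ⟨P, i, ht, rfl, rfl⟩
  · rintro ⟨P, i, hP, rfl, rfl⟩
    exact hP
  · exact h.exists_of_factorVia ht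
  · rintro ⟨P, Q, hP, rfl, rfl⟩
    exact hP

/-! ### Acyclicity and finiteness of the graph -/

theorem edge_left_mem {Q P : GAtom C} (he : (graphOf I).Edge A Q P) : Q ∈ (graphOf I).nodes := by
  rcases he with ⟨i, ax, σ, hc, hb, p, hp, rfl⟩ | hf
  · exact h.tru_of_needs hc (h.needs_of_chained hc hb hp)
  · exact (h.mem_nodes_of_factored hf).2

theorem edge_right_mem {Q P : GAtom C} (he : (graphOf I).Edge A Q P) :
    P ∈ (graphOf I).nodes := by
  rcases he with ⟨i, ax, σ, hc, hb, p, hp, rfl⟩ | hf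
  · exact h.mem_nodes_of_chained hc
  · exact (h.mem_nodes_of_factored hf).1

/-- The target of a factoring satisfies `fa`, which excludes back-chaining, and is not above another
atom of its cluster, which excludes factoring. -/
theorem not_edge_of_factored {P Q R : GAtom C} (hf : (P, Q) ∈ (graphOf I).factored) :
    ¬ (graphOf I).Edge A R Q := by
  rintro (⟨i, ax, σ, hc, _⟩ | hf')
  · exact h.not_inferVia_of_fa (h.fa_of_factorVia hf).2 hc
  · exact h.not_factorVia_of_factorVia hf hf'

/-- Factoring edges leave only `fa` atoms, so a path that starts at a back-chained atom uses
back-chainings only. Each of them feeds the one before it, which reverses the direction. -/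
theorem feeds_of_transGen {P Q : GAtom C} (hPQ : Relation.TransGen ((graphOf I).Edge A) P Q) :
    ∀ i, (P, i) ∈ (graphOf I).chained →
      ∃ j, (Q, j) ∈ (graphOf I).chained ∧ Relation.TransGen A.Feeds j i := by
  have key : ∀ {P Q : GAtom C}, (graphOf I).Edge A P Q → ∀ i, (P, i) ∈ (graphOf I).chained →
      ∃ j, (Q, j) ∈ (graphOf I).chained ∧ A.Feeds j i := by
    rintro P Q (⟨j, ax, σ, hc, hb, p, hp, rfl⟩ | hf) i hi
    · obtain ⟨bx, τ, hb'⟩ := h.exists_backchains hi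
      exact ⟨j, hc, ax, bx, hb.1, hb'.1, p, hp, σ, τ, hb'.2.1.symm⟩
    · exact (h.not_inferVia_of_fa (h.fa_of_factorVia hf).2 hi).elim
  induction hPQ with
  | single he => exact fun i hi => (key he i hi).imp fun j hj => ⟨hj.1, .single hj.2⟩
  | tail _ he ih =>
    intro i hi
    obtain ⟨j, hj, hf⟩ := ih i hi
    obtain ⟨k, hk, hf'⟩ := key he j hj
    exact ⟨k, hk, .head hf' hf⟩

/-- If the last edge of a cycle is a back-chaining, the cycle projects to `Feeds`; if it is a
factoring, its source would have an incoming edge. -/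
theorem acyclic (hA : A.Acyclic) (P : GAtom C) :
    ¬ Relation.TransGen ((graphOf I).Edge A) P P := by
  intro hP
  obtain ⟨Q, hPQ, he⟩ := Relation.TransGen.tail'_iff.1 hP
  rcases he with ⟨i, ax, σ, hc, _⟩ | hf
  · obtain ⟨j, hj, hf⟩ := h.feeds_of_transGen hP i hc
    obtain rfl := h.chained_unique hc hj
    exact hA _ hf
  · rcases hPQ.cases_tail with rfl | ⟨R, _, he⟩
    · exact h.not_edge_of_factored hf (.inr hf)
    · exact h.not_edge_of_factored hf he

/-- Induction over the axioms: a body atom of the `i`-th axiom can be back-chained only over an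
axiom that `i` feeds, and the body is finite. -/
theorem chainedFrom_finite (hA : A.Acyclic) (P : GAtom C) :
    ((graphOf I).chainedFrom A P).Finite := by
  refine Graph.chainedFrom_finite_of_forall fun i => ?_
  revert P
  refine hA.induction (p := fun i => ∀ P, (P, i) ∈ (graphOf I).chained →
    ((graphOf I).chainedFrom A P).Finite) (fun i ih P hP => ?_) i
  obtain ⟨ax, σ, hb⟩ := h.exists_backchains hP
  have hfin : (⋃ p ∈ {p | p ∈ ax.body}, (graphOf I).chainedFrom A (p.inst σ)).Finite :=
    ax.body.finite_toSet.biUnion fun p hp => Graph.chainedFrom_finite_of_forall fun j hj => by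
      obtain ⟨bx, τ, hb'⟩ := h.exists_backchains hj
      exact ih j ⟨ax, bx, hb.1, hb'.1, p, hp, σ, τ, hb'.2.1.symm⟩ _ hj
  refine (hfin.insert P).subset fun Q hQ => ?_
  rcases hQ.cases_head with rfl | ⟨R, ⟨j, bx, τ, hj, hb', p, hp, rfl⟩, hR⟩
  · exact Set.mem_insert _ _
  · obtain rfl := h.chained_unique hj hP
    obtain rfl := hb.axiom_eq hb'
    refine .inr (Set.mem_iUnion₂.2 ⟨p, hp, ?_⟩)
    rw [hb.inst_eq hb' hp]
    exact hR

theorem nodes_finite (hA : A.Acyclic) : (graphOf I).nodes.Finite := by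
  refine (A.goalAtoms_finite.biUnion fun P _ => h.chainedFrom_finite hA P).subset fun Q hQ => ?_
  -- `tru_induction` speaks of terms; the claim is restated for every atom that a term encodes.
  suffices ∀ Q' : GAtom C, Q.enc = Q'.enc →
    Q' ∈ ⋃ P ∈ A.goalAtoms, (graphOf I).chainedFrom A P from this Q rfl
  refine h.tru_induction (p := fun t => ∀ Q' : GAtom C, t = Q'.enc →
    Q' ∈ ⋃ P ∈ A.goalAtoms, (graphOf I).chainedFrom A P) ?_ ?_ hQ
  · rintro _ hg Q rfl
    exact Set.mem_iUnion₂.2 ⟨Q, h.goal_enc_iff.1 hg, .refl⟩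
  · rintro t R s ih h1 h2 Q rfl
    obtain ⟨P, i, ax, σ, p, hc, hb, hp, rfl, rfl, he⟩ := h.chained_of_needs h1 h2
    obtain ⟨G, hG, hP⟩ := Set.mem_iUnion₂.1 (ih P rfl)
    exact Set.mem_iUnion₂.2 ⟨G, hG, .tail hP
      ⟨i, ax, σ, hc, hb, p, hp, GAtom.enc_injective he⟩⟩

/-! ### The derivation of the hypothesis -/

theorem nodes_eq :
    (graphOf I).nodes = A.goalAtoms ∪ chainedChildren A (graphOf I).chained := by
  ext Q
  constructor
  · intro hQ
    cases h.supported hQ with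
    | tru_goal hg => exact .inl (h.goal_enc_iff.1 hg)
    | tru_needs h1 h2 =>
      obtain ⟨P, i, ax, σ, p, hc, hb, hp, rfl, rfl, he⟩ := h.chained_of_needs h1 h2
      exact .inr ⟨P, i, ax, σ, hc, hb, p, hp, GAtom.enc_injective he⟩
  · rintro (hQ | ⟨P, i, ax, σ, hc, hb, p, hp, rfl⟩)
    · exact h.tru_of_goal (h.goal_enc_iff.2 hQ)
    · exact h.tru_of_needs hc (h.needs_of_chained hc hb hp)

theorem unifiable_of_factored {P Q : GAtom C} (hf : (P, Q) ∈ (graphOf I).factored) :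
    A.Unifiable P Q := by
  obtain ⟨_, ts⟩ := P
  obtain ⟨_, ss⟩ := Q
  obtain ⟨_, _, _, hs, ht, _, _, _, h5⟩ := h.factorCluster_iff.1 (h.factorVia_iff.1 hf).1
  cases hs
  cases ht
  rw [List.forall₂_iff_zip] at h5
  refine ⟨rfl, h5.1.symm, ?_⟩
  rintro ⟨X, Y⟩ ⟨he, hne⟩
  -- `factorCluster` equates arguments with the smaller atom first, `unifEqs P Q` with the larger
  -- first.
  have hYX : (Y, X) ∈ ss.zip ts := by
    rw [← List.zip_swap]
    exact List.mem_map.2 ⟨_, he, rfl⟩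
  have heq := h5.2 hYX
  exact ⟨h.notSort_of_eq (h.eq_symm_mem heq) hne, h.notSort_of_eq heq (Ne.symm hne)⟩

theorem ne_of_factored (hlt : IsStrictTotalOrder (Term C) lt) {P Q : GAtom C}
    (hf : (P, Q) ∈ (graphOf I).factored) : P ≠ Q := by
  rintro rfl
  obtain ⟨_, _, _, _, _, h3, _⟩ := h.factorCluster_iff.1 (h.factorVia_iff.1 hf).1
  exact hlt.irrefl _ h3

theorem isProofGraph (hA : A.Acyclic) (hlt : IsStrictTotalOrder (Term C) lt) :
    IsProofGraph A (hypOf I) (graphOf I) := by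
  refine ⟨?_, rfl, h.acyclic hA⟩
  have hnodes := h.nodes_finite hA
  have hlen : ∀ P i, (P, i) ∈ (graphOf I).chained → i < A.axioms.length := fun P i hP => by
    obtain ⟨ax, σ, hb⟩ := h.exists_backchains hP
    exact (List.getElem?_eq_some_iff.1 hb.1).1
  have hchained : (graphOf I).chained.Finite :=
    (hnodes.prod (Set.finite_lt_nat A.axioms.length)).subset fun e he =>
      ⟨h.mem_nodes_of_chained he, hlen _ _ he⟩
  have hfactored : (graphOf I).factored.Finite :=
    (hnodes.prod hnodes).subset fun e he => h.mem_nodes_of_factored he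
  have hder := derives_of_grounded hchained (fun _ _ _ => h.chained_unique)
    (fun _ _ => h.exists_backchains) fun bc hbc hcl => by
      rintro ⟨P, i⟩ hP
      -- Groundedness: by induction on truth, every node is a goal atom or is added by a
      -- back-chaining that `bc` already contains.
      have key : ∀ {t}, tru t ∈ I → ∀ P : GAtom C, t = P.enc →
          P ∈ A.goalAtoms ∪ chainedChildren A bc := fun ht => by
        refine h.tru_induction (p := fun t => ∀ P : GAtom C, t = P.enc →
          P ∈ A.goalAtoms ∪ chainedChildren A bc) ?_ ?_ ht
        · rintro _ hg Q rfl
          exact .inl (h.goal_enc_iff.1 hg)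
        · rintro t R s ih h1 h2 Q rfl
          obtain ⟨P, i, ax, σ, p, hc, hb, hp, rfl, rfl, he⟩ := h.chained_of_needs h1 h2
          exact .inr ⟨P, i, ax, σ, hcl P i hc (ih P rfl), hb, p, hp, GAtom.enc_injective he⟩
      exact hcl P i hP (key (h.mem_nodes_of_chained hP) P rfl)
  rw [← h.nodes_eq] at hder
  exact hder.factorings hfactored (fun P Q hf => ⟨(h.mem_nodes_of_factored hf).1,
    (h.mem_nodes_of_factored hf).2, h.ne_of_factored hlt hf, h.not_chained_of_factored hf,
    h.unifiable_of_factored hf⟩) fun P Q R hQ hR =>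
      GAtom.enc_injective (h.factorVia_unique hlt hQ hR)

/-- The abduced nodes are the atoms with `abduce`. -/
theorem mem_abducedNodes_iff (hbody : ∀ ax ∈ A.axioms, ax.body ≠ []) {P : GAtom C} :
    P ∈ (graphOf I).abducedNodes A ↔ abduce P.enc ∈ I := by
  rw [h.abduce_iff, h.factor_iff, h.fa_iff]
  constructor
  · rintro ⟨hP, hne⟩
    refine ⟨(h.infer_or_fai hP).resolve_left fun hi => ?_, ?_⟩
    · obtain ⟨R, hR⟩ := h.exists_inferVia hi
      obtain ⟨i, ax, σ, Q, hb, rfl, hQ⟩ := h.inferVia_iff_exists hR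
      obtain rfl := GAtom.enc_injective hQ
      -- With an empty body, a back-chained atom could lack incoming edges without being abduced.
      obtain ⟨p, hp⟩ := List.exists_mem_of_ne_nil _ (hbody ax (List.mem_of_getElem? hb.1))
      exact hne _ (.inl ⟨i, ax, σ, hR, hb, p, hp, rfl⟩)
    · rintro ⟨s, hs⟩
      obtain ⟨Q, P', he, _, hP'⟩ := h.edge_iff.1 (.inr hs)
      obtain rfl := GAtom.enc_injective hP'
      exact hne Q he
  · rintro ⟨hf, hn⟩
    refine ⟨h.tru_of_fai hf, ?_⟩
    rintro Q (⟨i, ax, σ, hc, _⟩ | hf')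
    · exact h.not_inferVia_of_fa (h.fa_iff.2 hf) hc
    · exact hn ⟨_, hf'⟩

theorem exists_of_abduce {t : Term C} (ht : abduce t ∈ I) : ∃ P : GAtom C, t = P.enc :=
  h.exists_of_tru (h.tru_of_fai (h.fa_iff.1 (h.abduce_iff.1 ht).1))

theorem abducedNodes_finite (hA : A.Acyclic) : ((graphOf I).abducedNodes A).Finite :=
  (h.nodes_finite hA).subset fun _ hP => hP.1

end BaseModel

/-! ## Costs of interpretations as sums over graphs -/

/-- Costs are summed over distinct weight–tuple pairs; injectivity ensures that no two summands are
merged. -/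
theorem answerCost_eq_finsum {P : EProgram C} {β : Type*} {s : Set β} {f : β → ℤ × List (Term C)}
    (hf : Set.InjOn f s) (hs : violations lt P I = f '' s) :
    answerCost lt P I = ∑ᶠ a ∈ s, (f a).1 := by
  rw [answerCost, hs, finsum_mem_image hf]

theorem finsum_mem_one_eq_ncard {β : Type*} {s : Set β} (hs : s.Finite) :
    ∑ᶠ _a ∈ s, (1 : ℤ) = s.ncard := by
  rw [finsum_mem_eq_finite_toFinset_sum _ hs, Set.ncard_eq_toFinset_card s hs]
  simp

/-! ## Cardinality -/

theorem BaseModel.violations_card (h : BaseModel A lt I)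
    (hbody : ∀ ax ∈ A.axioms, ax.body ≠ []) :
    violations lt ((progBwda A lt).union progCard) I =
      (fun P : GAtom C => ((1 : ℤ), [P.enc])) '' (graphOf I).abducedNodes A := by
  ext e
  constructor
  · rintro ⟨_, hk | ⟨t, rfl⟩, hsat, rfl⟩
    · exact hk.elim
    · simp only [satAll_cons, satAll_nil, sat_pos, and_true] at hsat
      obtain ⟨P, rfl⟩ := h.exists_of_abduce hsat
      exact ⟨P, (h.mem_abducedNodes_iff hbody).2 hsat, rfl⟩
  · rintro ⟨P, hP, rfl⟩
    exact ⟨_, .inr ⟨P.enc, rfl⟩, by simpa only [satAll_cons, satAll_nil, sat_pos, and_true] using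
      (h.mem_abducedNodes_iff hbody).1 hP, rfl⟩

/-! ## Coherence -/

namespace BaseModel

variable (h : BaseModel A lt I)
include h

/-- The rules extend a path at its start: foundedness of `reach` gives one direction, induction on
the path from its end `F` the other. -/
theorem reach_iff (hcoh : ∀ r ∈ (progCoh lt).rules, r.ReductSat lt I I) {t f : Term C} :
    reach t f ∈ I ↔ ∃ F ∈ A.goalAtoms, ∃ N ∈ (graphOf I).nodes, t = N.enc ∧ f = F.enc ∧
      Relation.ReflTransGen ((graphOf I).Edge A) N F := by
  constructor
  · intro ht
    have := h.founded {a | ∀ t f, a = reach t f → ∃ F ∈ A.goalAtoms, ∃ N ∈ (graphOf I).nodes,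
      t = N.enc ∧ f = F.enc ∧ Relation.ReflTransGen ((graphOf I).Edge A) N F} fun a _ hs => by
        have step : ∀ {t' t f}, reach t' f ∈ I ∩ {a | ∀ t f, a = reach t f → ∃ F ∈ A.goalAtoms,
            ∃ N ∈ (graphOf I).nodes, t = N.enc ∧ f = F.enc ∧
              Relation.ReflTransGen ((graphOf I).Edge A) N F} →
            ((∃ R, inferVia R t' ∈ I ∧ inferenceNeeds t' R t ∈ I) ∨ factorVia t' t ∈ I) →
            ∃ F ∈ A.goalAtoms, ∃ N ∈ (graphOf I).nodes, t = N.enc ∧ f = F.enc ∧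
              Relation.ReflTransGen ((graphOf I).Edge A) N F := by
          intro t' t f hr he
          obtain ⟨F, hF, M, _, rfl, rfl, hM⟩ := hr.2 _ _ rfl
          obtain ⟨N, M', he, rfl, hMM⟩ := h.edge_iff.1 he
          obtain rfl := GAtom.enc_injective hMM
          exact ⟨F, hF, N, h.edge_left_mem he, rfl, rfl, .head he hM⟩
        rintro t f rfl
        cases hs with
        | reach_goal hg =>
          obtain ⟨F, hF, rfl⟩ := h.goal_iff.1 hg.1
          exact ⟨F, hF, F, h.tru_of_goal hg.1, rfl, rfl, .refl⟩
        | reach_needs h1 h2 h3 => exact step h1 (.inl ⟨_, h2.1, h3.1⟩)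
        | reach_factor h1 h2 => exact step h1 (.inr h2.1)
    exact this ht t f rfl
  · rintro ⟨F, hF, N, -, rfl, rfl, hr⟩
    induction hr using Relation.ReflTransGen.head_induction_on with
    | refl =>
      exact mem_of_rule hcoh (Or.inl (Or.inl (Or.inl ⟨F.enc, rfl⟩)))
        (by simpa only [satAll_cons, satAll_nil, sat_pos, and_true] using h.goal_enc_iff.2 hF)
    | head he _ ih =>
      rcases h.edge_iff.2 ⟨_, _, he, rfl, rfl⟩ with ⟨R, h1, h2⟩ | hf
      · exact mem_of_rule hcoh (Or.inl (Or.inl (Or.inr ⟨_, F.enc, R, _, rfl⟩)))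
          (by simpa only [satAll_cons, satAll_nil, sat_pos, and_true] using ⟨ih, h1, h2⟩)
      · exact mem_of_rule hcoh (Or.inl (Or.inr ⟨_, F.enc, _, rfl⟩))
          (by simpa only [satAll_cons, satAll_nil, sat_pos, and_true] using ⟨ih, hf⟩)

theorem reachFromBoth_iff (hcoh : ∀ r ∈ (progCoh lt).rules, r.ReductSat lt I I)
    {P Q : GAtom C} (hP : P ∈ A.goalAtoms) (hQ : Q ∈ A.goalAtoms) (hPQ : lt P.enc Q.enc) :
    reachFromBoth P.enc Q.enc ∈ I ↔ ∃ n ∈ (graphOf I).nodes,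
      Relation.ReflTransGen ((graphOf I).Edge A) n P ∧
      Relation.ReflTransGen ((graphOf I).Edge A) n Q := by
  constructor
  · intro hr
    have hs := h.supported hr
    generalize hs1 : P.enc = s at hs
    generalize hs2 : Q.enc = t at hs
    cases hs with
    | reachFromBoth _ _ _ h4 h5 =>
      obtain ⟨P', _, N, hN, rfl, hP', hr1⟩ := (h.reach_iff hcoh).1 h4
      obtain ⟨Q', _, N', _, hNN, hQ', hr2⟩ := (h.reach_iff hcoh).1 h5
      obtain rfl := GAtom.enc_injective (hs1.trans hP')
      obtain rfl := GAtom.enc_injective (hs2.trans hQ')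
      obtain rfl := GAtom.enc_injective hNN
      exact ⟨N, hN, hr1, hr2⟩
  · rintro ⟨N, hN, hr1, hr2⟩
    refine mem_of_rule hcoh (Or.inr ⟨P.enc, Q.enc, N.enc, hPQ, rfl⟩) ?_
    simp only [satAll_cons, satAll_nil, sat_pos, and_true]
    exact ⟨h.goal_enc_iff.2 hP, h.goal_enc_iff.2 hQ,
      (h.reach_iff hcoh).2 ⟨P, hP, N, hN, rfl, rfl, hr1⟩,
      (h.reach_iff hcoh).2 ⟨Q, hQ, N, hN, rfl, rfl, hr2⟩⟩

theorem violations_coh (hcoh : ∀ r ∈ (progCoh lt).rules, r.ReductSat lt I I) :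
    violations lt ((progBwda A lt).union (progCoh lt)) I =
      (fun e : GAtom C × GAtom C => ((1 : ℤ), [e.1.enc, e.2.enc])) ''
        unconnectedPairs A lt (graphOf I) := by
  ext e
  constructor
  · rintro ⟨_, hk | ⟨s, t, hst, rfl⟩, hsat, rfl⟩
    · exact hk.elim
    · simp only [satAll_cons, satAll_nil, sat_pos, sat_naf, and_true] at hsat
      obtain ⟨hs, ht, hn⟩ := hsat
      obtain ⟨P, hP, rfl⟩ := h.goal_iff.1 hs
      obtain ⟨Q, hQ, rfl⟩ := h.goal_iff.1 ht
      exact ⟨(P, Q), ⟨hP, hQ, hst, fun hr => hn ((h.reachFromBoth_iff hcoh hP hQ hst).2 hr)⟩, rfl⟩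
  · rintro ⟨⟨P, Q⟩, ⟨hP, hQ, hst, hn⟩, rfl⟩
    refine ⟨_, .inr ⟨P.enc, Q.enc, hst, rfl⟩, ?_, rfl⟩
    simp only [satAll_cons, satAll_nil, sat_pos, sat_naf, and_true]
    exact ⟨h.goal_enc_iff.2 hP, h.goal_enc_iff.2 hQ, fun hr =>
      hn ((h.reachFromBoth_iff hcoh hP hQ hst).1 hr)⟩

end BaseModel

theorem unconnectedPairs_finite (G : Graph C) : (unconnectedPairs A lt G).Finite :=
  (A.goalAtoms_finite.prod A.goalAtoms_finite).subset fun _ he => ⟨he.1, he.2.1⟩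

/-! ## Weighted abduction -/

/-- The costs of `Q` that result from the costs `μ P m` of the atoms `P`. -/
def costStep (A : Instance C) (ic : GAtom C → ℝ) (w : ℕ → ℕ → ℝ) (ρ : ℝ → ℝ) (G : Graph C)
    (μ : GAtom C → ℝ → Prop) (Q : GAtom C) : Set ℝ :=
  {x | Q ∈ A.goalAtoms ∧ x = ic Q} ∪
  {x | ∃ P i ax σ k p m, (P, i) ∈ G.chained ∧ A.Backchains i ax σ P ∧
    ax.body[k]? = some p ∧ Q = p.inst σ ∧ μ P m ∧ x = ρ (m * w i k)} ∪
  {x | ∃ P, (P, Q) ∈ G.factored ∧ μ P x}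

section CostStep

variable {ic : GAtom C → ℝ} {w : ℕ → ℕ → ℝ} {ρ : ℝ → ℝ} {G : Graph C} {μ ν : GAtom C → ℝ → Prop}
  {Q : GAtom C}

/-- Comparing `μ` and `ν` only at the atoms to which `Q` has an edge is what permits induction along
edges. -/
theorem costStep_mono (hμν : ∀ P, G.Edge A Q P → ∀ m, μ P m → ν P m) :
    costStep A ic w ρ G μ Q ⊆ costStep A ic w ρ G ν Q := by
  rintro x ((hx | ⟨P, i, ax, σ, k, p, m, h1, h2, h3, h4, h5, h6⟩) | ⟨P, h1, h2⟩)
  · exact .inl (.inl hx)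
  · exact .inl (.inr ⟨P, i, ax, σ, k, p, m, h1, h2, h3, h4,
      hμν P (.inl ⟨i, ax, σ, h1, h2, p, List.mem_of_getElem? h3, h4⟩) m h5, h6⟩)
  · exact .inr ⟨P, h1, hμν P (.inr h1) x h2⟩

theorem costStep_congr (hμν : ∀ P, G.Edge A Q P → ∀ m, μ P m ↔ ν P m) :
    costStep A ic w ρ G μ Q = costStep A ic w ρ G ν Q :=
  (costStep_mono fun P hP m => (hμν P hP m).1).antisymm
    (costStep_mono fun P hP m => (hμν P hP m).2)

theorem isLeast_iff_of_subset {s t : Set ℝ} (hst : s ⊆ t) (hts : ∀ y ∈ t, ∃ x ∈ s, x ≤ y) (x : ℝ) :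
    IsLeast s x ↔ IsLeast t x := by
  constructor
  · rintro ⟨h1, h2⟩
    refine ⟨hst h1, fun y hy => ?_⟩
    obtain ⟨z, hz, hzy⟩ := hts y hy
    exact (h2 hz).trans hzy
  · rintro ⟨h1, h2⟩
    obtain ⟨z, hz, hzx⟩ := hts x h1
    obtain rfl := hzx.antisymm (h2 (hst hz))
    exact ⟨hz, fun y hy => h2 (hst hy)⟩

/-- The least cost of an atom is determined by the least costs of its parents. -/
theorem isLeast_costStep_iff (hw : ∀ i k, 0 ≤ w i k) (hρ : Monotone ρ)
    (hμν : ∀ P m, μ P m → ν P m) (hνμ : ∀ P m, ν P m → ∃ m' ≤ m, μ P m') (x : ℝ) :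
    IsLeast (costStep A ic w ρ G μ Q) x ↔ IsLeast (costStep A ic w ρ G ν Q) x := by
  refine isLeast_iff_of_subset (costStep_mono fun P _ => hμν P) ?_ x
  rintro y ((hx | ⟨P, i, ax, σ, k, p, m, h1, h2, h3, h4, h5, rfl⟩) | ⟨P, h1, h2⟩)
  · exact ⟨y, .inl (.inl hx), le_rfl⟩
  · obtain ⟨m', hm, hm'⟩ := hνμ P m h5
    exact ⟨_, .inl (.inr ⟨P, i, ax, σ, k, p, m', h1, h2, h3, h4, hm', rfl⟩),
      hρ (mul_le_mul_of_nonneg_right hm (hw i k))⟩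
  · obtain ⟨m', hm, hm'⟩ := hνμ P y h2
    exact ⟨m', .inr ⟨P, h1, hm'⟩, hm⟩

end CostStep

theorem roundCost_mono : Monotone roundCost := fun x y hxy => by
  unfold roundCost
  gcongr

theorem uniformWeight_nonneg (A : Instance C) (i k : ℕ) : 0 ≤ uniformWeight A i k := by
  unfold uniformWeight
  split <;> positivity

/-- Division by a natural number commutes with the floor, so the two successive integer divisions,
by `5` and by the number of body atoms, amount to rounding down once. -/
theorem roundCost_uniformWeight {i : ℕ} {ax : HornAxiom C} (hax : A.axioms[i]? = some ax) (k : ℕ)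
    (x : ℤ) : roundCost (x * uniformWeight A i k) =
      ((max ((x * 6 / 5) / (ax.body.length : ℤ)) 1 : ℤ) : ℝ) := by
  have h1 : (x : ℝ) * ((6 / 5) / (ax.body.length : ℝ)) =
      ((x * 6 : ℤ) : ℝ) / ((5 : ℕ) : ℝ) / (ax.body.length : ℝ) := by
    push_cast
    ring
  simp only [roundCost, uniformWeight, hax]
  rw [h1, Int.floor_div_natCast, Int.floor_div_natCast, Int.floor_intCast]
  push_cast
  rfl

theorem aggMax_pair_iff
    (hint : ∀ m n : ℤ, lt (.int m) (.int n) ↔ m < n) {M : Term C} {a b : ℤ} :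
    (aggMax M {(Term.int a, []), (Term.int b, [])} : Lit (Term C) (EAtom C)).Sat lt I ↔
      M = .int (max a b) := by
  have hval : aggValues I ({(Term.int a, []), (Term.int b, [])} : Set (Term C × List (EAtom C))) =
      {.int a, .int b} := by
    ext t
    constructor
    · rintro ⟨_, he | he, _⟩ <;> cases he
      exacts [.inl rfl, .inr rfl]
    · rintro (rfl | rfl)
      exacts [⟨[], .inl rfl, by simp⟩, ⟨[], .inr rfl, by simp⟩]
  simp only [Lit.Sat, hval]
  constructor
  · rintro ⟨rfl | rfl, h2⟩
    · have := h2 _ (.inr rfl)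
      rw [hint, not_lt] at this
      rw [max_eq_left this]
    · have := h2 _ (.inl rfl)
      rw [hint, not_lt] at this
      rw [max_eq_right this]
  · rintro rfl
    refine ⟨?_, ?_⟩
    · rcases max_choice a b with hm | hm <;> rw [hm]
      exacts [.inl rfl, .inr rfl]
    · rintro y (rfl | rfl) <;> rw [hint, not_lt]
      exacts [le_max_left _ _, le_max_right _ _]

/-- The costs of the atom `P` in the interpretation `I`. -/
def costSet (I : Set (EAtom C)) (P : GAtom C) : Set ℝ :=
  {x | ∃ k : ℤ, pcost P.enc (.int k) ∈ I ∧ x = k}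

theorem intCast_mem_costSet {P : GAtom C} {k : ℤ} :
    (k : ℝ) ∈ costSet I P ↔ pcost P.enc (.int k) ∈ I :=
  ⟨fun ⟨_, hj, he⟩ => Int.cast_injective he ▸ hj, fun hk => ⟨k, hk, rfl⟩⟩

namespace BaseModel

variable (h : BaseModel A lt I)
include h

theorem numberOfBodies_iff (hwa : ∀ r ∈ (progWA A).rules, r.ReductSat lt I I) {i : ℕ}
    {ax : HornAxiom C} (hax : A.axioms[i]? = some ax) {n : ℤ} :
    numberOfBodies (.rid i) (.int n) ∈ I ↔ n = ax.body.length := by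
  constructor
  · intro hn
    cases h.supported hn with
    | numberOfBodies hbx => rw [Option.some.inj (hax.symm.trans hbx)]
  · rintro rfl
    exact mem_of_rule hwa (Or.inl (Or.inl (Or.inl (Or.inl ⟨i, ax, hax, rfl⟩)))) (satAll_nil.2 ⟨⟩)

variable (hint : ∀ m n : ℤ, lt (.int m) (.int n) ↔ m < n)
include hint

/-! ### Costs in the interpretation and in the labelling -/

theorem exists_int_of_pcost {t X : Term C} (ht : pcost t X ∈ I) :
    ∃ k : ℤ, 1 ≤ k ∧ X = .int k := by
  have := h.founded {a | ∀ t X, a = pcost t X → ∃ k : ℤ, 1 ≤ k ∧ X = .int k} fun a _ hs => by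
    rintro t X rfl
    cases hs with
    | pcost_goal _ => exact ⟨100, by norm_num, rfl⟩
    | pcost_needs _ _ hM _ _ =>
      exact ⟨_, le_max_right _ _, (aggMax_pair_iff hint).1 hM⟩
    | pcost_factor _ hp => exact hp.2 _ _ rfl
  exact this ht t X rfl

/-- Costs are integers bounded below by `1`, so no finiteness of the cost set is needed. -/
theorem exists_isLeast_costSet {P : GAtom C} (hP : (costSet I P).Nonempty) :
    ∃ k : ℤ, IsLeast (costSet I P) k := by
  obtain ⟨_, k, hk, rfl⟩ := hP
  obtain ⟨l, hl, hmin⟩ := Int.exists_least_of_bdd (P := fun k => pcost P.enc (.int k) ∈ I)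
    ⟨1, fun z hz => by
      obtain ⟨j, hj, he⟩ := h.exists_int_of_pcost hint hz
      cases he
      exact hj⟩ ⟨k, hk⟩
  refine ⟨l, ⟨l, hl, rfl⟩, ?_⟩
  rintro _ ⟨j, hj, rfl⟩
  exact_mod_cast hmin j hj

/-- The rules for `pcost` pass on every cost of a parent, hence membership stands where a labelling
has `IsLeast`. -/
theorem costSet_eq (hbody : ∀ ax ∈ A.axioms, ax.body ≠ [])
    (hwa : ∀ r ∈ (progWA A).rules, r.ReductSat lt I I) (Q : GAtom C) :
    costSet I Q = costStep A (fun _ => 100) (uniformWeight A) roundCost (graphOf I)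
      (fun P m => m ∈ costSet I P) Q := by
  ext x
  constructor
  · rintro ⟨k, hk, rfl⟩
    have hs := h.supported hk
    generalize ht : Q.enc = t at hs
    generalize hM : Term.int k = M at hs
    cases hs with
    | pcost_goal hg =>
      cases hM
      exact .inl (.inl ⟨h.goal_enc_iff.1 (ht ▸ hg), by norm_num⟩)
    | pcost_needs h1 h2 h3 h4 h5 =>
      obtain ⟨P, i, ax, σ, p, hc, hb, hp, rfl, rfl, rfl⟩ := h.chained_of_needs h1 h2
      rw [aggMax_pair_iff hint] at h3
      rw [h.numberOfBodies_iff hwa hb.1] at h5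
      subst h5
      cases hM.trans h3
      obtain ⟨j, hj⟩ := List.mem_iff_getElem?.1 hp
      exact .inl (.inr ⟨P, i, ax, σ, j, p, _, hc, hb, hj, GAtom.enc_injective ht, ⟨_, h4, rfl⟩,
        (roundCost_uniformWeight hb.1 j _).symm⟩)
    | pcost_factor h1 h2 =>
      subst hM
      obtain ⟨P, Q', hf, rfl, rfl⟩ := h.exists_of_factorVia h1
      obtain rfl := GAtom.enc_injective ht
      exact .inr ⟨P, hf, k, h2, rfl⟩
  · rintro ((⟨hQ, rfl⟩ | ⟨P, i, ax, σ, j, p, _, hc, hb, hj, rfl, ⟨m, hm, rfl⟩, rfl⟩) |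
      ⟨P, hf, k, hk, rfl⟩)
    · exact ⟨100, mem_of_rule hwa (Or.inl (Or.inl (Or.inl (Or.inr ⟨Q.enc, rfl⟩))))
        (by simpa only [satAll_cons, satAll_nil, sat_pos, and_true] using h.goal_enc_iff.2 hQ),
        by norm_num⟩
    · refine ⟨_, ?_, roundCost_uniformWeight hb.1 j m⟩
      -- The division rule has ground instances for nonzero divisors only.
      have hne : (ax.body.length : ℤ) ≠ 0 := by
        have := hbody ax (List.mem_of_getElem? hb.1)
        simpa using this
      refine mem_of_rule hwa (Or.inl (Or.inl (Or.inr
        ⟨P.enc, .rid i, (p.inst σ).enc, _, m, ax.body.length, hne, rfl⟩))) ?_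
      simp only [satAll_cons, satAll_nil, sat_pos, and_true]
      exact ⟨hc, h.needs_of_chained hc hb (List.mem_of_getElem? hj),
        (aggMax_pair_iff hint).2 rfl, hm, (h.numberOfBodies_iff hwa hb.1).2 rfl⟩
    · exact ⟨k, mem_of_rule hwa (Or.inl (Or.inr ⟨P.enc, Q.enc, .int k, rfl⟩))
        (by simpa only [satAll_cons, satAll_nil, sat_pos, and_true] using ⟨hf, hk⟩), rfl⟩

theorem isLeast_costStep_iff_costSet (hbody : ∀ ax ∈ A.axioms, ax.body ≠ [])
    (hwa : ∀ r ∈ (progWA A).rules, r.ReductSat lt I I) (Q : GAtom C) (x : ℝ) :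
    IsLeast (costStep A (fun _ => 100) (uniformWeight A) roundCost (graphOf I)
      (fun P m => IsLeast (costSet I P) m) Q) x ↔ IsLeast (costSet I Q) x := by
  rw [h.costSet_eq hint hbody hwa Q]
  refine isLeast_costStep_iff (uniformWeight_nonneg A) roundCost_mono (fun _ _ hm => hm.1)
    (fun P m hm => ?_) x
  obtain ⟨k, hk⟩ := h.exists_isLeast_costSet hint ⟨m, hm⟩
  exact ⟨k, hk.2 hm, hk⟩

/-- One propagation of the minima of `costSet` reproduces these minima, so the result is already a
fixed point. -/
theorem isCostLabelling_costStep (hbody : ∀ ax ∈ A.axioms, ax.body ≠ [])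
    (hwa : ∀ r ∈ (progWA A).rules, r.ReductSat lt I I) :
    IsCostLabelling A (fun _ => 100) (uniformWeight A) roundCost (graphOf I)
      (costStep A (fun _ => 100) (uniformWeight A) roundCost (graphOf I)
        (fun P m => IsLeast (costSet I P) m)) := fun _ =>
  costStep_congr fun P _ m => (h.isLeast_costStep_iff_costSet hint hbody hwa P m).symm

theorem isLeast_of_isCostLabelling (hA : A.Acyclic) (hbody : ∀ ax ∈ A.axioms, ax.body ≠ [])
    (hwa : ∀ r ∈ (progWA A).rules, r.ReductSat lt I I) {κ : GAtom C → Set ℝ}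
    (hκ : IsCostLabelling A (fun _ => 100) (uniformWeight A) roundCost (graphOf I) κ)
    {Q : GAtom C} (hQ : Q ∈ (graphOf I).nodes) (x : ℝ) :
    IsLeast (κ Q) x ↔ IsLeast (costSet I Q) x := by
  -- Costs flow against the edges: the atoms reachable from `Q` come before `Q`.
  let r : GAtom C → GAtom C → Prop := fun P Q => Relation.TransGen ((graphOf I).Edge A) Q P
  have : IsStrictOrder (GAtom C) r :=
    { irrefl := h.acyclic hA
      trans := fun _ _ _ h1 h2 => h2.trans h1 }
  have hwf : (graphOf I).nodes.WellFoundedOn r := (h.nodes_finite hA).wellFoundedOn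
  revert x
  refine hwf.induction (P := fun Q => ∀ x, IsLeast (κ Q) x ↔ IsLeast (costSet I Q) x) hQ ?_
  intro Q hQ ih x
  rw [← h.isLeast_costStep_iff_costSet hint hbody hwa Q x]
  have hstep : κ Q = costStep A (fun _ => 100) (uniformWeight A) roundCost (graphOf I)
      (fun P m => IsLeast (κ P) m) Q := hκ Q
  rw [hstep, costStep_congr fun P hP m => ih P (h.edge_right_mem hP) (.single hP) m]

/-- Goal atoms cost `100`, and back-chaining passes a cost to each body atom; these two cases
exhaust `true`. -/
theorem costSet_nonempty (hbody : ∀ ax ∈ A.axioms, ax.body ≠ [])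
    (hwa : ∀ r ∈ (progWA A).rules, r.ReductSat lt I I) {Q : GAtom C}
    (hQ : Q ∈ (graphOf I).nodes) : (costSet I Q).Nonempty := by
  suffices ∀ Q' : GAtom C, Q.enc = Q'.enc → (costSet I Q').Nonempty from this Q rfl
  refine h.tru_induction (p := fun t => ∀ Q' : GAtom C, t = Q'.enc → (costSet I Q').Nonempty)
    ?_ ?_ hQ
  · rintro _ hg Q rfl
    rw [h.costSet_eq hint hbody hwa Q]
    exact ⟨100, .inl (.inl ⟨h.goal_enc_iff.1 hg, rfl⟩)⟩
  · rintro t R s ih h1 h2 Q rfl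
    obtain ⟨P, i, ax, σ, p, hc, hb, hp, rfl, rfl, he⟩ := h.chained_of_needs h1 h2
    obtain ⟨m, hm⟩ := ih P rfl
    obtain ⟨j, hj⟩ := List.mem_iff_getElem?.1 hp
    rw [h.costSet_eq hint hbody hwa Q]
    exact ⟨_, .inl (.inr ⟨P, i, ax, σ, j, p, m, hc, hb, hj, GAtom.enc_injective he, hm, rfl⟩)⟩

theorem cost_iff (hbody : ∀ ax ∈ A.axioms, ax.body ≠ [])
    (hwa : ∀ r ∈ (progWA A).rules, r.ReductSat lt I I) {t X : Term C} :
    cost t X ∈ I ↔ ∃ P ∈ (graphOf I).abducedNodes A, ∃ k : ℤ, t = P.enc ∧ X = .int k ∧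
      IsLeast (costSet I P) k := by
  -- `#min` uses the order of all ground terms; since every `pcost` value is an integer, it is the
  -- usual minimum.
  have hagg : ∀ P : GAtom C, ∀ k : ℤ,
      (aggMin (.int k) {e | ∃ Y, e = (Y, [pcost P.enc Y])} : Lit (Term C) (EAtom C)).Sat lt I ↔
        IsLeast (costSet I P) k := by
    intro P k
    have hval : ∀ Y, Y ∈ aggValues I {e | ∃ Y, e = (Y, [pcost P.enc Y])} ↔
        pcost P.enc Y ∈ I := by
      intro Y
      constructor
      · rintro ⟨_, ⟨Z, he⟩, hc⟩
        cases he
        exact hc _ (List.mem_singleton.2 rfl)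
      · intro hY
        exact ⟨_, ⟨Y, rfl⟩, by simpa using hY⟩
    simp only [Lit.Sat, hval]
    refine and_congr intCast_mem_costSet.symm ⟨?_, ?_⟩
    · rintro hm _ ⟨j, hj, rfl⟩
      have := hm _ hj
      rw [hint, not_lt] at this
      exact_mod_cast this
    · intro hm Y hY
      obtain ⟨j, _, rfl⟩ := h.exists_int_of_pcost hint hY
      rw [hint, not_lt]
      exact_mod_cast hm ⟨j, hY, rfl⟩
  constructor
  · intro ht
    cases h.supported ht with
    | cost h1 h2 =>
      obtain ⟨P, rfl⟩ := h.exists_of_abduce h1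
      obtain ⟨_, ⟨Y, he⟩, hc⟩ := h2.1
      cases he
      obtain ⟨k, _, rfl⟩ := h.exists_int_of_pcost hint (hc _ (List.mem_singleton.2 rfl))
      exact ⟨P, (h.mem_abducedNodes_iff hbody).2 h1, k, rfl, rfl, (hagg P k).1 h2⟩
  · rintro ⟨P, hP, k, rfl, rfl, hk⟩
    refine mem_of_rule hwa (Or.inr ⟨P.enc, .int k, rfl⟩) ?_
    simp only [satAll_cons, satAll_nil, sat_pos, and_true]
    exact ⟨(h.mem_abducedNodes_iff hbody).1 hP, (hagg P k).2 hk⟩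

theorem exists_int_of_cost (hbody : ∀ ax ∈ A.axioms, ax.body ≠ [])
    (hwa : ∀ r ∈ (progWA A).rules, r.ReductSat lt I I) {t X : Term C} (ht : cost t X ∈ I) :
    ∃ n : ℤ, 1 ≤ n ∧ X = .int n := by
  obtain ⟨P, _, k, rfl, rfl, hk⟩ := (h.cost_iff hint hbody hwa).1 ht
  exact h.exists_int_of_pcost hint (intCast_mem_costSet.1 hk.1)

theorem violations_wa (hbody : ∀ ax ∈ A.axioms, ax.body ≠ [])
    (hwa : ∀ r ∈ (progWA A).rules, r.ReductSat lt I I) {c : GAtom C → ℤ}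
    (hc : ∀ P ∈ (graphOf I).nodes, IsLeast (costSet I P) (c P)) :
    violations lt ((progBwda A lt).union (progWA A)) I =
      (fun P : GAtom C => (c P, [P.enc])) '' (graphOf I).abducedNodes A := by
  ext e
  constructor
  · rintro ⟨_, hk | ⟨t, n, rfl⟩, hsat, rfl⟩
    · exact hk.elim
    · simp only [satAll_cons, satAll_nil, sat_pos, and_true] at hsat
      obtain ⟨P, hP, k, rfl, he, hk⟩ := (h.cost_iff hint hbody hwa).1 hsat
      cases he
      have : c P = n := Int.cast_injective ((hc P hP.1).unique hk)
      exact ⟨P, hP, Prod.ext this rfl⟩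
  · rintro ⟨P, hP, rfl⟩
    refine ⟨_, .inr ⟨P.enc, c P, rfl⟩, ?_, rfl⟩
    simp only [satAll_cons, satAll_nil, sat_pos, and_true]
    exact (h.cost_iff hint hbody hwa).2 ⟨P, hP, c P, rfl, rfl, hc P hP.1⟩

/-- Left to right is uniqueness, as any labelling has the minima `c` on the nodes; right to left is
existence of a labelling. -/
theorem isWAObj_iff (hA : A.Acyclic) (hbody : ∀ ax ∈ A.axioms, ax.body ≠ [])
    (hwa : ∀ r ∈ (progWA A).rules, r.ReductSat lt I I) {c : GAtom C → ℤ}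
    (hc : ∀ P ∈ (graphOf I).nodes, IsLeast (costSet I P) (c P)) (v : ℝ) :
    IsWAObj A (fun _ => 100) (uniformWeight A) roundCost (graphOf I) v ↔
      v = ((∑ᶠ P ∈ (graphOf I).abducedNodes A, c P : ℤ) : ℝ) := by
  have hfin := h.abducedNodes_finite hA
  have hcast : ((∑ᶠ P ∈ (graphOf I).abducedNodes A, c P : ℤ) : ℝ) =
      ∑ᶠ P ∈ (graphOf I).abducedNodes A, (c P : ℝ) := by
    rw [finsum_mem_eq_finite_toFinset_sum _ hfin, finsum_mem_eq_finite_toFinset_sum _ hfin]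
    push_cast
    rfl
  rw [hcast]
  constructor
  · rintro ⟨κ, m, hκ, _, hm, rfl⟩
    exact finsum_mem_congr rfl fun P hP => ((h.isLeast_of_isCostLabelling hint hA hbody hwa hκ
      hP.1 _).1 (hm P hP)).unique (hc P hP.1)
  · rintro rfl
    exact ⟨_, fun P => c P, h.isCostLabelling_costStep hint hbody hwa, hfin,
      fun P hP => (h.isLeast_costStep_iff_costSet hint hbody hwa P _).2 (hc P hP.1), rfl⟩

theorem exists_isLeast_of_nodes (hbody : ∀ ax ∈ A.axioms, ax.body ≠ [])
    (hwa : ∀ r ∈ (progWA A).rules, r.ReductSat lt I I) :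
    ∃ c : GAtom C → ℤ, ∀ P ∈ (graphOf I).nodes, IsLeast (costSet I P) (c P) := by
  choose! c hc using fun P (hP : P ∈ (graphOf I).nodes) => h.exists_isLeast_costSet hint
    (h.costSet_nonempty hint hbody hwa hP)
  exact ⟨c, hc⟩

end BaseModel
end AbdASP

/-! ### The correspondence for the three modules -/

theorem mainTheorem3 {C : Type*} (A : AbdASP.Instance C)
    (hbody : ∀ ax ∈ A.axioms, ax.body ≠ [])
    (hacyclic : A.Acyclic)
    (lt : AbdASP.Term C → AbdASP.Term C → Prop)
    (hlt : IsStrictTotalOrder (AbdASP.Term C) lt)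
    (hint : ∀ m n : ℤ, lt (.int m) (.int n) ↔ m < n) :
    (∀ I, AbdASP.IsAnswerSet lt ((AbdASP.progBwda A lt).union AbdASP.progCard) I →
      ∃ H G, AbdASP.IsProofGraph A H G ∧ AbdASP.Represents A I G ∧
        (AbdASP.violations lt ((AbdASP.progBwda A lt).union AbdASP.progCard) I).Finite ∧
        (G.abducedNodes A).Finite ∧
        AbdASP.answerCost lt ((AbdASP.progBwda A lt).union AbdASP.progCard) I =
          (AbdASP.cardObj A G : ℤ)) ∧
    (∀ I, AbdASP.IsAnswerSet lt ((AbdASP.progBwda A lt).union (AbdASP.progCoh lt)) I →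
      ∃ H G, AbdASP.IsProofGraph A H G ∧ AbdASP.Represents A I G ∧
        (AbdASP.violations lt ((AbdASP.progBwda A lt).union (AbdASP.progCoh lt)) I).Finite ∧
        (AbdASP.unconnectedPairs A lt G).Finite ∧
        AbdASP.answerCost lt ((AbdASP.progBwda A lt).union (AbdASP.progCoh lt)) I =
          (AbdASP.cohObj A lt G : ℤ)) ∧
    (∀ I, AbdASP.IsAnswerSet lt ((AbdASP.progBwda A lt).union (AbdASP.progWA A)) I →
      ∃ H G, AbdASP.IsProofGraph A H G ∧ AbdASP.Represents A I G ∧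
        (AbdASP.violations lt ((AbdASP.progBwda A lt).union (AbdASP.progWA A)) I).Finite ∧
        (∀ P X, AbdASP.EAtom.cost P X ∈ I → ∃ n : ℤ, 1 ≤ n ∧ X = .int n) ∧
        ∀ v : ℝ,
          AbdASP.IsWAObj A (fun _ => 100) (AbdASP.uniformWeight A) AbdASP.roundCost G v ↔
            v = (AbdASP.answerCost lt
              ((AbdASP.progBwda A lt).union (AbdASP.progWA A)) I : ℝ)) := by
  refine ⟨fun I hI => ?_, fun I hI => ?_, fun I hI => ?_⟩
  · have h := hI.baseModel (by
      rintro r (hr | hr)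
      exacts [.inl (.inl hr), hr.elim])
    have hv := h.violations_card hbody
    have hfin := h.abducedNodes_finite hacyclic
    refine ⟨_, _, h.isProofGraph hacyclic hlt, h.represents, hv ▸ hfin.image _, hfin, ?_⟩
    rw [AbdASP.answerCost_eq_finsum (fun P _ Q _ hPQ => AbdASP.GAtom.enc_injective
      (List.cons.inj (Prod.mk.inj hPQ).2).1) hv]
    exact AbdASP.finsum_mem_one_eq_ncard hfin
  · have h := hI.baseModel (by
      rintro r (hr | hr)
      exacts [.inl (.inl hr), .inl (.inr hr)])
    have hv := h.violations_coh fun r hr => hI.2.1 r (.inr hr)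
    have hfin := AbdASP.unconnectedPairs_finite (A := A) (lt := lt) (AbdASP.graphOf I)
    refine ⟨_, _, h.isProofGraph hacyclic hlt, h.represents, hv ▸ hfin.image _, hfin, ?_⟩
    rw [AbdASP.answerCost_eq_finsum (fun P _ Q _ hPQ => ?_) hv]
    · exact AbdASP.finsum_mem_one_eq_ncard hfin
    · have h2 := List.cons.inj (Prod.mk.inj hPQ).2
      exact Prod.ext (AbdASP.GAtom.enc_injective h2.1)
        (AbdASP.GAtom.enc_injective (List.cons.inj h2.2).1)
  · have h := hI.baseModel (by
      rintro r (hr | hr)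
      exacts [.inl (.inl hr), .inr hr])
    have hwa : ∀ r ∈ (AbdASP.progWA A).rules, r.ReductSat lt I I := fun r hr =>
      hI.2.1 r (.inr hr)
    obtain ⟨c, hc⟩ := h.exists_isLeast_of_nodes hint hbody hwa
    have hv := h.violations_wa hint hbody hwa hc
    refine ⟨_, _, h.isProofGraph hacyclic hlt, h.represents,
      hv ▸ (h.abducedNodes_finite hacyclic).image _,
      fun P X => h.exists_int_of_cost hint hbody hwa, fun v => ?_⟩
    rw [AbdASP.answerCost_eq_finsum (fun P _ Q _ hPQ => AbdASP.GAtom.enc_injective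
      (List.cons.inj (Prod.mk.inj hPQ).2).1) hv]
    exact h.isWAObj_iff hint hacyclic hbody hwa hc v
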